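/- Let $k$ be a field and let $H=(H,\Delta,\varepsilon,\phi,S,\alpha,\beta)$ be a finite dimensional quasi-Hopf algebra over $k$: $H$ is an associative unital algebra, $\Delta:H\to H\otimes H$, $h\mapsto h_1\otimes h_2$, and $\varepsilon:H\to k$ are algebra maps, $\phi=X^1\otimes X^2\otimes X^3\in H^{\otimes 3}$ is invertible with inverse $\phi^{-1}=x^1\otimes x^2\otimes x^3$ (summation understood), and $S:H\to H$ is a (unital) anti-algebra map, $\alpha,\beta\in H$, such that for all $h\in H$ $$\phi\,(\Delta\otimes I)\Delta(h)\,\phi^{-1}=(I\otimes\Delta)\Delta(h),\quad (I\otimes\varepsilon)\Delta(h)=(\varepsilon\otimes I)\Delta(h)=h,$$ $$(I\otimes I\otimes\Delta)(\phi)(\Delta\otimes I\otimes I)(\phi)=(1\otimes\phi)(I\otimes\Delta\otimes I)(\phi)(\phi\otimes1),\quad (I\otimes\varepsilon\otimes I)(\phi)=1\otimes 1,$$ $$S(h_1)\alpha h_2=\varepsilon(h)\alpha,\quad h_1\beta S(h_2)=\varepsilon(h)\beta,\quad X^1\beta S(X^2)\alpha X^3=1,\quad S(x^1)\alpha x^2\beta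 S(x^3)=1.$$ Let $t\in H$ be a nonzero left integral, i.e. $ht=\varepsilon(h)t$ for all $h\in H$. Let $A$ be a left $H$-module algebra: a left $H$-module with a bilinear multiplication (not necessarily associative) and a unit $1_A$ such that $$(ab)c=(X^1\cdot a)[(X^2\cdot b)(X^3\cdot c)],\quad h\cdot(ab)=(h_1\cdot a)(h_2\cdot b),\quad h\cdot 1_A=\varepsilon(h)1_A .$$ Let $A\#H$ be the smash product, i.e. $A\otimes H$ with the associative multiplication $(a\#h)(b\#g)=(x^1\cdot a)(x^2h_1\cdot b)\#x^3h_2g$ and unit $1_A\#1$, and let $B=A^H=\{a\in A: h\cdot a=\varepsilon(h)a\ \forall h\in H\}$, an associative algebra under the multiplication of $A$. Then $A$ is a left $A\#H$-module via $(a\#h)b=a(h\cdot b)$, and a left and a right $B$-module by multiplication in $A$. Then the following hold. 1. The antipode $S$ is bijective, and there is an algebra map $\gamma:H\to k$ with $sh=\gamma(h)s$ for all left integrals $s$ and all $h\in H$ (it is unique, since $t\neq0$). Put $p_L=p_L^1\otimes p_L^2=X^2S^{-1}(X^1\beta)\otimes X^3$, $q_L=q_L^1\otimes q_L^2=S(x^1)\alpha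 x^2\otimes x^3$, $\Lambda=\gamma(q_L^2)q_L^1$ and $\gamma\rightharpoonup h=\gamma(h_2)h_1$. 2. The map $a\mapsto\varphi(t\otimes a)$, where $\varphi(h\otimes a)=h_1p_L^1\cdot a\#h_2p_L^2$, is a bijection from $A$ onto $(A\#H)^H=\{x\in A\#H:(1_A\#h)x=\varepsilon(h)x\ \forall h\in H\}$, and the formula $$a\cdot_\gamma(b\#h)=S^{-1}\big(S(X^2)\Lambda(\gamma\rightharpoonup X^3h)\big)\cdot\big[(p_L^1S^{-1}(X^1)\cdot a)(p_L^2\cdot b)\big]$$ defines a right $A\#H$-module structure on $A$, which is the one transported along this bijection from right multiplication: $\varphi(t\otimes(a\cdot_\gamma x))=\varphi(t\otimes a)\,x$ for $a\in A$, $x\in A\#H$. 3. With this structure $A$ is an $(A\#H,B)$-bimodule and a $(B,A\#H)$-bimodule, and the maps $$(-,-):A\otimes_{A\#H}A\to B,\quad (a,b)=t\cdot[(p_L^1\cdot a)(p_L^2\cdot b)],$$ $$[-,-]:A\otimes_BA\to A\#H,\quad [a,b]=(a\#t)(p_L^1\cdot b\#p_L^2)$$ make $(A\#H,\,B,\,{}_{A\#H}A_B,\,{}_BA_{A\#H},\,(-,-),\,[-,-])$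 a Morita context; that is, $(-,-)$ is a well-defined (balanced) $B$-bimodule map, $[-,-]$ is a well-defined (balanced) $A\#H$-bimodule map, and $[a,b]\,c=a\,(b,c)$ and $(a,b)\,c=a\cdot_\gamma[b,c]$ for all $a,b,c\in A$. -/

import Mathlib

open scoped TensorProduct
open MulOpposite

set_option maxSynthPendingDepth 8

/-- A quasi-bialgebra `(H, Δ, ε, φ)` over a field `k`. Triple and fourfold tensor powers are
bracketed to the right; `associator` is the invertible element `φ`. -/
class QuasiBialgebra (k H : Type*) [Field k] [Ring H] [Algebra k H] where
  /-- The coproduct `Δ`. -/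
  comul : H →ₐ[k] H ⊗[k] H
  /-- The counit `ε`. -/
  counit : H →ₐ[k] k
  /-- The associator `φ`. -/
  associator : (H ⊗[k] (H ⊗[k] H))ˣ
  /-- `φ (Δ ⊗ I)(Δ h) φ⁻¹ = (I ⊗ Δ)(Δ h)`. -/
  coassoc : ∀ h : H,
    (associator : H ⊗[k] (H ⊗[k] H)) *
        Algebra.TensorProduct.assoc k k k H H H
          (Algebra.TensorProduct.map comul (AlgHom.id k H) (comul h)) *
        ((associator⁻¹ : (H ⊗[k] (H ⊗[k] H))ˣ) : H ⊗[k] (H ⊗[k] H)) =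
      Algebra.TensorProduct.map (AlgHom.id k H) comul (comul h)
  /-- `(I ⊗ ε)(Δ h) = h`. -/
  counit_right : ∀ h : H,
    Algebra.TensorProduct.rid k k H
      (Algebra.TensorProduct.map (AlgHom.id k H) counit (comul h)) = h
  /-- `(ε ⊗ I)(Δ h) = h`. -/
  counit_left : ∀ h : H,
    Algebra.TensorProduct.lid k H
      (Algebra.TensorProduct.map counit (AlgHom.id k H) (comul h)) = h
  /-- `(I ⊗ I ⊗ Δ)(φ) (Δ ⊗ I ⊗ I)(φ) = (1 ⊗ φ) (I ⊗ Δ ⊗ I)(φ) (φ ⊗ 1)`. -/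
  pentagon :
    Algebra.TensorProduct.map (AlgHom.id k H)
          (Algebra.TensorProduct.map (AlgHom.id k H) comul) associator.val *
        Algebra.TensorProduct.assoc k k k H H (H ⊗[k] H)
          (Algebra.TensorProduct.map comul (AlgHom.id k (H ⊗[k] H)) associator.val) =
      ((1 : H) ⊗ₜ[k] associator.val) *
        Algebra.TensorProduct.map (AlgHom.id k H)
          ((Algebra.TensorProduct.assoc k k k H H H).toAlgHom.comp
            (Algebra.TensorProduct.map comul (AlgHom.id k H))) associator.val *
        Algebra.TensorProduct.map (AlgHom.id k H)
          (Algebra.TensorProduct.map (AlgHom.id k H)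
            (Algebra.TensorProduct.includeLeft : H →ₐ[k] H ⊗[k] H)) associator.val
  /-- `(I ⊗ ε ⊗ I)(φ) = 1 ⊗ 1`. -/
  counit_associator :
    Algebra.TensorProduct.map (AlgHom.id k H)
        ((Algebra.TensorProduct.lid k H).toAlgHom.comp
          (Algebra.TensorProduct.map counit (AlgHom.id k H))) associator.val = 1

/-- A quasi-Hopf algebra `(H, Δ, ε, φ, S, α, β)` over a field `k`. -/
class QuasiHopfAlgebra (k H : Type*) [Field k] [Ring H] [Algebra k H] extends
    QuasiBialgebra k H where
  /-- The antipode `S`. -/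
  antipode : H →ₗ[k] H
  antipode_one : antipode 1 = 1
  antipode_mul : ∀ g h : H, antipode (g * h) = antipode h * antipode g
  /-- The element `α`. -/
  alpha : H
  /-- The element `β`. -/
  beta : H
  /-- `S(h₁) α h₂ = ε(h) α`. -/
  antipode_alpha : ∀ h : H,
    LinearMap.mul' k H
        (TensorProduct.map (LinearMap.mulRight k alpha ∘ₗ antipode) LinearMap.id (comul h)) =
      counit h • alpha
  /-- `h₁ β S(h₂) = ε(h) β`. -/
  beta_antipode : ∀ h : H,
    LinearMap.mul' k H
        (TensorProduct.map (LinearMap.mulRight k beta) antipode (comul h)) =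
      counit h • beta
  /-- `X¹ β S(X²) α X³ = 1`, where `φ = X¹ ⊗ X² ⊗ X³`. -/
  associator_beta_alpha :
    LinearMap.mul' k H
      (TensorProduct.map (LinearMap.mulRight k beta)
        (LinearMap.mul' k H ∘ₗ
          TensorProduct.map (LinearMap.mulRight k alpha ∘ₗ antipode) LinearMap.id)
        associator.val) = 1
  /-- `S(x¹) α x² β S(x³) = 1`, where `φ⁻¹ = x¹ ⊗ x² ⊗ x³`. -/
  associator_inv_alpha_beta :
    LinearMap.mul' k H
      (TensorProduct.map (LinearMap.mulRight k alpha ∘ₗ antipode)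
        (LinearMap.mul' k H ∘ₗ TensorProduct.map (LinearMap.mulRight k beta) antipode)
        associator.inv) = 1

namespace QuasiHopf

section Basic

variable (k : Type*) {H : Type*} [Field k] [Ring H] [Algebra k H]

/-- `Δ`. -/
abbrev comul [QuasiBialgebra k H] : H →ₐ[k] H ⊗[k] H := QuasiBialgebra.comul

/-- `ε`. -/
abbrev counit [QuasiBialgebra k H] : H →ₐ[k] k := QuasiBialgebra.counit

variable (H) in
/-- `φ`. -/
abbrev phi [QuasiBialgebra k H] : H ⊗[k] (H ⊗[k] H) := (QuasiBialgebra.associator (k := k)).val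

variable (H) in
/-- `φ⁻¹`. -/
abbrev phiInv [QuasiBialgebra k H] : H ⊗[k] (H ⊗[k] H) := (QuasiBialgebra.associator (k := k)).inv

/-- `S`. -/
abbrev antipode [QuasiHopfAlgebra k H] : H →ₗ[k] H := QuasiHopfAlgebra.antipode

variable (H) in
/-- `α`. -/
abbrev alpha [QuasiHopfAlgebra k H] : H := QuasiHopfAlgebra.alpha k

variable (H) in
/-- `β`. -/
abbrev beta [QuasiHopfAlgebra k H] : H := QuasiHopfAlgebra.beta k

/-- `t` is a left integral: `h t = ε(h) t` for all `h`. -/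
def IsLeftIntegral [QuasiBialgebra k H] (t : H) : Prop := ∀ h : H, h * t = counit k h • t

variable (H) in
open Classical in
/-- The inverse `S⁻¹` of the antipode (with the value `0` if `S` is not bijective). -/
noncomputable def antipodeInv [QuasiHopfAlgebra k H] : H →ₗ[k] H :=
  if hS : Function.Bijective (antipode k (H := H)) then
    (LinearEquiv.ofBijective (antipode k (H := H)) hS).symm.toLinearMap
  else 0

/-- `γ` is a modular element: `t h = γ(h) t` for all left integrals `t` and all `h`. -/
def IsModular [QuasiBialgebra k H] (γ : H →ₐ[k] k) : Prop :=
  ∀ t : H, IsLeftIntegral k t → ∀ h : H, t * h = γ h • t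

variable (H) in
open Classical in
/-- The modular element `γ` of `H` (with the value `ε` if there is no algebra map `γ` such that
`t h = γ(h) t` for all left integrals `t` and all `h`). -/
noncomputable def modularElement [QuasiBialgebra k H] : H →ₐ[k] k :=
  if hγ : ∃ γ : H →ₐ[k] k, IsModular k γ then hγ.choose else counit k

variable (H) in
/-- `p_L = X² S⁻¹(X¹ β) ⊗ X³`, where `φ = X¹ ⊗ X² ⊗ X³`. -/
noncomputable def pL [QuasiHopfAlgebra k H] : H ⊗[k] H :=
  TensorProduct.map
    (LinearMap.mul' k H ∘ₗ (TensorProduct.comm k H H).toLinearMap ∘ₗ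
      TensorProduct.map (antipodeInv k H ∘ₗ LinearMap.mulRight k (beta k H)) LinearMap.id)
    LinearMap.id ((TensorProduct.assoc k H H H).symm (phi k H))

variable (H) in
/-- `q_L = S(x¹) α x² ⊗ x³`, where `φ⁻¹ = x¹ ⊗ x² ⊗ x³`. -/
noncomputable def qL [QuasiHopfAlgebra k H] : H ⊗[k] H :=
  TensorProduct.map
    (LinearMap.mul' k H ∘ₗ
      TensorProduct.map (LinearMap.mulRight k (alpha k H) ∘ₗ antipode k) LinearMap.id)
    LinearMap.id ((TensorProduct.assoc k H H H).symm (phiInv k H))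

variable (H) in
/-- `Λ = γ(q_L²) q_L¹`. -/
noncomputable def Lam [QuasiHopfAlgebra k H] : H :=
  TensorProduct.rid k H
    (TensorProduct.map LinearMap.id (modularElement k H).toLinearMap (qL k H))

variable (H) in
/-- `h ↦ γ ⇀ h = γ(h₂) h₁`. -/
noncomputable def gammaHarpoon [QuasiBialgebra k H] : H →ₗ[k] H :=
  (TensorProduct.rid k H).toLinearMap ∘ₗ
    TensorProduct.map LinearMap.id (modularElement k H).toLinearMap ∘ₗ (comul k).toLinearMap

end Basic

section Actions

variable (k : Type*) (H : Type*) {A : Type*} [Field k] [Ring H] [Algebra k H]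
  [NonAssocRing A] [Module k A] [IsScalarTower k A A] [SMulCommClass k A A]
  [Module H A] [IsScalarTower k H A]

/-- `h ↦ h · a`. -/
def orbit (a : A) : H →ₗ[k] A := (LinearMap.toSpanSingleton H A a).restrictScalars k

/-- `h ⊗ g ↦ (h · a)(g · b)`. -/
noncomputable def actMul (a b : A) : H ⊗[k] H →ₗ[k] A :=
  LinearMap.mul' k A ∘ₗ TensorProduct.map (orbit k H a) (orbit k H b)

/-- `h ⊗ g ⊗ l ↦ (h · a)[(g · b)(l · c)]`. -/
noncomputable def actMulMul (a b c : A) : H ⊗[k] (H ⊗[k] H) →ₗ[k] A :=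
  LinearMap.mul' k A ∘ₗ TensorProduct.map (orbit k H a) (actMul k H b c)

end Actions

end QuasiHopf

/-- `A` is a left `H`-module algebra: a left `H`-module with a unital, bilinear, not necessarily
associative multiplication that makes it an algebra in the monoidal category of left
`H`-modules. -/
class QuasiModuleAlgebra (k H A : Type*) [Field k] [Ring H] [Algebra k H] [QuasiBialgebra k H]
    [NonAssocRing A] [Module k A] [IsScalarTower k A A] [SMulCommClass k A A]
    [Module H A] [IsScalarTower k H A] : Prop where
  /-- `(a b) c = (X¹ · a)[(X² · b)(X³ · c)]`. -/
  mul_mul : ∀ a b c : A, (a * b) * c = QuasiHopf.actMulMul k H a b c (QuasiHopf.phi k H)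
  /-- `h · (a b) = (h₁ · a)(h₂ · b)`. -/
  smul_mul : ∀ (h : H) (a b : A), h • (a * b) = QuasiHopf.actMul k H a b (QuasiHopf.comul k h)
  /-- `h · 1 = ε(h) 1`. -/
  smul_one : ∀ h : H, h • (1 : A) = QuasiHopf.counit k h • (1 : A)

namespace QuasiHopf

variable (k H A : Type*) [Field k] [Ring H] [Algebra k H]
  [NonAssocRing A] [Module k A] [IsScalarTower k A A] [SMulCommClass k A A]
  [Module H A] [IsScalarTower k H A]

set_option linter.unusedSectionVars false

section Lemmas

variable {A}

@[simp] theorem orbit_apply (a : A) (h : H) : orbit k H a h = h • a := rfl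

theorem orbit_add (a b : A) : orbit k H (a + b) = orbit k H a + orbit k H b := by
  ext h; simp

theorem orbit_smul (c : k) (a : A) : orbit k H (c • a) = c • orbit k H a := by
  have := IsScalarTower.to_smulCommClass (R := k) (A := H) (M := A)
  ext h; exact smul_comm h c a

@[simp] theorem actMul_tmul (a b : A) (h g : H) :
    actMul k H a b (h ⊗ₜ g) = (h • a) * (g • b) := by simp [actMul]

theorem actMul_add_left (a a' b : A) : actMul k H (a + a') b = actMul k H a b + actMul k H a' b := by
  ext; simp [add_mul]

theorem actMul_add_right (a b b' : A) :
    actMul k H a (b + b') = actMul k H a b + actMul k H a b' := by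
  ext; simp [mul_add]

theorem actMul_smul_left (c : k) (a b : A) : actMul k H (c • a) b = c • actMul k H a b := by
  have := IsScalarTower.to_smulCommClass (R := k) (A := H) (M := A)
  ext; simp [smul_comm _ c, smul_mul_assoc]

theorem actMul_smul_right (c : k) (a b : A) : actMul k H a (c • b) = c • actMul k H a b := by
  have := IsScalarTower.to_smulCommClass (R := k) (A := H) (M := A)
  ext; simp [smul_comm _ c, mul_smul_comm]

theorem actMul_mul_tmul (a b : A) (p : H ⊗[k] H) (h g : H) :
    actMul k H a b (p * h ⊗ₜ g) = actMul k H (h • a) (g • b) p := by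
  induction p with
  | zero => simp
  | tmul x y => simp [mul_smul]
  | add x y hx hy => simp [add_mul, hx, hy]

@[simp] theorem actMulMul_tmul (a b c : A) (h : H) (p : H ⊗[k] H) :
    actMulMul k H a b c (h ⊗ₜ p) = (h • a) * actMul k H b c p := by simp [actMulMul]

theorem actMulMul_mul_tmul (a b c : A) (w : H ⊗[k] (H ⊗[k] H)) (h g l : H) :
    actMulMul k H a b c (w * h ⊗ₜ (g ⊗ₜ l)) = actMulMul k H (h • a) (g • b) (l • c) w := by
  induction w with
  | zero => simp
  | tmul x y => simp [mul_smul, actMul_mul_tmul]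
  | add x y hx hy => simp [add_mul, hx, hy]

end Lemmas

/-- The smash product `A # H`: the vector space `A ⊗ H` with its own multiplication. -/
def SmashProduct : Type _ := A ⊗[k] H

namespace SmashProduct

noncomputable instance : AddCommGroup (SmashProduct k H A) :=
  inferInstanceAs (AddCommGroup (A ⊗[k] H))

noncomputable instance : Module k (SmashProduct k H A) :=
  inferInstanceAs (Module k (A ⊗[k] H))

variable {A} in
/-- The element `a # h`. -/
def mk (a : A) (h : H) : SmashProduct k H A := a ⊗ₜ[k] h

variable {A} in
/-- `x ⊗ y ⊗ z ↦ (x · a)(y · b) # z`. -/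
noncomputable def mulAux (a b : A) : H ⊗[k] (H ⊗[k] H) →ₗ[k] A ⊗[k] H :=
  TensorProduct.map (actMul k H a b) LinearMap.id ∘ₗ (TensorProduct.assoc k H H H).symm.toLinearMap

variable [QuasiBialgebra k H]

variable {A} in
/-- For fixed `a`, `h`: the map `b # g ↦ (x¹ · a)(x² h₁ · b) # x³ h₂ g`, where
`φ⁻¹ = x¹ ⊗ x² ⊗ x³`. -/
noncomputable def mulLeftAux (a : A) (h : H) : A ⊗[k] H →ₗ[k] A ⊗[k] H :=
  TensorProduct.lift (LinearMap.mk₂ k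
    (fun b g => mulAux k H a b (phiInv k H * (1 ⊗ₜ[k] (comul k h * (1 ⊗ₜ[k] g)))))
    (fun b b' g => by simp [mulAux, actMul_add_right, TensorProduct.map_add_left])
    (fun c b g => by simp [mulAux, actMul_smul_right, TensorProduct.map_smul_left])
    (fun b g g' => by simp [TensorProduct.tmul_add, mul_add])
    (fun c b g => by
      rw [TensorProduct.tmul_smul, mul_smul_comm, TensorProduct.tmul_smul, mul_smul_comm,
        map_smul]))

/-- The multiplication of `A # H`:
`(a # h)(b # g) = (x¹ · a)(x² h₁ · b) # x³ h₂ g`, where `φ⁻¹ = x¹ ⊗ x² ⊗ x³`. -/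
noncomputable def mulMap : A ⊗[k] H →ₗ[k] A ⊗[k] H →ₗ[k] A ⊗[k] H :=
  TensorProduct.lift (LinearMap.mk₂ k (fun a h => mulLeftAux k H a h)
    (fun a a' h => by
      ext b g; simp [mulLeftAux, mulAux, actMul_add_left, TensorProduct.map_add_left])
    (fun c a h => by
      ext b g; simp [mulLeftAux, mulAux, actMul_smul_left, TensorProduct.map_smul_left])
    (fun a h h' => by
      ext b g; simp [mulLeftAux, TensorProduct.tmul_add, mul_add, add_mul])
    (fun c a h => by
      ext b g
      change mulAux k H a b _ = c • mulAux k H a b _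
      rw [map_smul, smul_mul_assoc, TensorProduct.tmul_smul, mul_smul_comm, map_smul]))

noncomputable instance : Mul (SmashProduct k H A) := ⟨fun x y => mulMap k H A x y⟩

noncomputable instance : One (SmashProduct k H A) := ⟨mk k H 1 1⟩

section RingStructure

variable {k H A}

theorem mul_mk (a b : A) (h g : H) :
    mk k H a h * mk k H b g =
      mulAux k H a b (phiInv k H * (1 ⊗ₜ[k] (comul k h * (1 ⊗ₜ[k] g)))) := rfl

@[simp] theorem mulAux_tmul (a b : A) (x y z : H) :
    mulAux k H a b (x ⊗ₜ (y ⊗ₜ z)) = ((x • a) * (y • b)) ⊗ₜ z := by simp [mulAux]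

/-- `x ⊗ y ⊗ z ⊗ w ↦ (x · a)[(y · b)(z · c)] # w`. -/
noncomputable def mulAux₃ (a b c : A) : H ⊗[k] (H ⊗[k] (H ⊗[k] H)) →ₗ[k] A ⊗[k] H :=
  TensorProduct.map (LinearMap.mul' k A) LinearMap.id ∘ₗ
    (TensorProduct.assoc k A A H).symm.toLinearMap ∘ₗ
    TensorProduct.map (orbit k H a) (mulAux k H b c)

@[simp] theorem mulAux₃_tmul (a b c : A) (x y z w : H) :
    mulAux₃ a b c (x ⊗ₜ[k] (y ⊗ₜ[k] (z ⊗ₜ[k] w))) = ((x • a) * ((y • b) * (z • c))) ⊗ₜ w := by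
  simp [mulAux₃]

/-- `Δ ⊗ I ⊗ I`. -/
noncomputable abbrev D₁ : H ⊗[k] (H ⊗[k] H) →ₐ[k] H ⊗[k] (H ⊗[k] (H ⊗[k] H)) :=
  (Algebra.TensorProduct.assoc k k k H H (H ⊗[k] H)).toAlgHom.comp
    (Algebra.TensorProduct.map (comul k) (AlgHom.id k (H ⊗[k] H)))

/-- `I ⊗ Δ ⊗ I`. -/
noncomputable abbrev D₂ : H ⊗[k] (H ⊗[k] H) →ₐ[k] H ⊗[k] (H ⊗[k] (H ⊗[k] H)) :=
  Algebra.TensorProduct.map (AlgHom.id k H)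
    ((Algebra.TensorProduct.assoc k k k H H H).toAlgHom.comp
      (Algebra.TensorProduct.map (comul k) (AlgHom.id k H)))

/-- `I ⊗ I ⊗ Δ`. -/
noncomputable abbrev D₃ : H ⊗[k] (H ⊗[k] H) →ₐ[k] H ⊗[k] (H ⊗[k] (H ⊗[k] H)) :=
  Algebra.TensorProduct.map (AlgHom.id k H)
    (Algebra.TensorProduct.map (AlgHom.id k H) (comul k))

/-- `w ↦ w ⊗ 1`. -/
noncomputable abbrev E₁ : H ⊗[k] (H ⊗[k] H) →ₐ[k] H ⊗[k] (H ⊗[k] (H ⊗[k] H)) :=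
  Algebra.TensorProduct.map (AlgHom.id k H)
    (Algebra.TensorProduct.map (AlgHom.id k H)
      (Algebra.TensorProduct.includeLeft : H →ₐ[k] H ⊗[k] H))

theorem phi_mul_phiInv : phi k H * phiInv k H = 1 := Units.mul_inv _

theorem phiInv_mul_phi : phiInv k H * phi k H = 1 := Units.inv_mul _

theorem pentagon_inv :
    E₁ (phi k H) * D₁ (phiInv k H) * D₃ (phiInv k H) =
      D₂ (phiInv k H) * ((1 : H) ⊗ₜ[k] phiInv k H) := by
  have hp : D₃ (phi k H) * D₁ (phi k H) =
      ((1 : H) ⊗ₜ[k] phi k H) * D₂ (phi k H) * E₁ (phi k H) := QuasiBialgebra.pentagon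
  have h1 : D₁ (phi k H) * D₁ (phiInv k H) = 1 := by rw [← map_mul, phi_mul_phiInv, map_one]
  have h3 : D₃ (phi k H) * D₃ (phiInv k H) = 1 := by rw [← map_mul, phi_mul_phiInv, map_one]
  have h2 : D₂ (phiInv k H) * D₂ (phi k H) = 1 := by rw [← map_mul, phiInv_mul_phi, map_one]
  have h4 : ((1 : H) ⊗ₜ[k] phiInv k H) * ((1 : H) ⊗ₜ[k] phi k H) = 1 := by
    rw [Algebra.TensorProduct.tmul_mul_tmul, phiInv_mul_phi, one_mul]; rfl
  calc E₁ (phi k H) * D₁ (phiInv k H) * D₃ (phiInv k H)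
      = D₂ (phiInv k H) * ((((1 : H) ⊗ₜ[k] phiInv k H) * ((1 : H) ⊗ₜ[k] phi k H)) *
          D₂ (phi k H)) * E₁ (phi k H) * D₁ (phiInv k H) * D₃ (phiInv k H) := by
        rw [h4, one_mul, h2, one_mul]
    _ = D₂ (phiInv k H) * ((1 : H) ⊗ₜ[k] phiInv k H) *
          (((1 : H) ⊗ₜ[k] phi k H) * D₂ (phi k H) * E₁ (phi k H)) *
          D₁ (phiInv k H) * D₃ (phiInv k H) := by simp only [mul_assoc]
    _ = _ := by
        rw [← hp]
        simp only [mul_assoc]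
        rw [← mul_assoc (D₁ (phi k H)), h1, one_mul, h3, mul_one]

theorem phiInv_coassoc (h : H) :
    phiInv k H * Algebra.TensorProduct.map (AlgHom.id k H) (comul k) (comul k h) =
      Algebra.TensorProduct.assoc k k k H H H
          (Algebra.TensorProduct.map (comul k) (AlgHom.id k H) (comul k h)) * phiInv k H := by
  rw [← QuasiBialgebra.coassoc h]
  have := phiInv_mul_phi (k := k) (H := H)
  calc _ = (phiInv k H * phi k H) * Algebra.TensorProduct.assoc k k k H H H
          (Algebra.TensorProduct.map (comul k) (AlgHom.id k H) (comul k h)) * phiInv k H := by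
        simp only [mul_assoc]; rfl
    _ = _ := by rw [this, one_mul]

variable [QuasiModuleAlgebra k H A]

theorem mulAux_actMul_left (a b c : A) (p : H ⊗[k] H) (v : H ⊗[k] (H ⊗[k] H)) :
    mulAux k H (actMul k H a b p) c v =
      mulAux₃ a b c (E₁ (phi k H) * (D₁ v *
        Algebra.TensorProduct.assoc k k k H H (H ⊗[k] H) (p ⊗ₜ[k] 1))) := by
  have key : ∀ (d p : H ⊗[k] H) (y z : H),
      (actMul k H a b (d * p) * (y • c)) ⊗ₜ[k] z = mulAux₃ a b c (E₁ (phi k H) *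
        (Algebra.TensorProduct.assoc k k k H H (H ⊗[k] H) (d ⊗ₜ[k] (y ⊗ₜ[k] z)) *
        Algebra.TensorProduct.assoc k k k H H (H ⊗[k] H) (p ⊗ₜ[k] 1))) := by
    intro d p y z
    induction d with
    | zero => simp
    | add d d' hd hd' =>
      simp only [add_mul, map_add, TensorProduct.add_tmul, mul_add] at hd hd' ⊢
      rw [hd, hd']
    | tmul d₁ d₂ =>
      induction p with
      | zero => simp
      | add d d' hd hd' =>
        simp only [add_mul, map_add, TensorProduct.add_tmul, mul_add] at hd hd' ⊢
        rw [hd, hd']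
      | tmul p₁ p₂ =>
        simp only [Algebra.TensorProduct.tmul_mul_tmul, actMul_tmul,
          Algebra.TensorProduct.assoc_tmul, mul_one, QuasiModuleAlgebra.mul_mul (k := k) (H := H)]
        generalize phi k H = w
        induction w with
        | zero => simp
        | add w w' hw hw' => simp only [map_add, TensorProduct.add_tmul, add_mul, hw, hw']
        | tmul w₁ w =>
          induction w with
          | zero => simp
          | add w w' hw hw' =>
            simp only [TensorProduct.tmul_add, map_add, TensorProduct.add_tmul, add_mul, hw, hw']
          | tmul w₂ w₃ => simp [mul_smul]
  induction v with
  | zero => simp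
  | add v v' hv hv' => simp only [map_add, add_mul, mul_add, hv, hv']
  | tmul v₁ v =>
    induction v with
    | zero => simp
    | add v v' hv hv' => simp only [TensorProduct.tmul_add, map_add, add_mul, mul_add, hv, hv']
    | tmul v₂ v₃ =>
      rw [mulAux_tmul]
      have : v₁ • actMul k H a b p = actMul k H a b (comul k v₁ * p) := by
        induction p with
        | zero => simp
        | add p p' hp hp' => simp only [map_add, smul_add, mul_add, hp, hp']
        | tmul p₁ p₂ => rw [actMul_tmul, QuasiModuleAlgebra.smul_mul (k := k), actMul_mul_tmul]
      rw [this, key]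
      rfl

theorem mulAux_actMul_right (a b c : A) (p : H ⊗[k] H) (v : H ⊗[k] (H ⊗[k] H)) :
    mulAux k H a (actMul k H b c p) v =
      mulAux₃ a b c (D₂ v * ((1 : H) ⊗ₜ[k] Algebra.TensorProduct.assoc k k k H H H
        (p ⊗ₜ[k] 1))) := by
  have key : ∀ (d p : H ⊗[k] H) (x z : H),
      ((x • a) * actMul k H b c (d * p)) ⊗ₜ[k] z = mulAux₃ a b c
        ((x ⊗ₜ[k] Algebra.TensorProduct.assoc k k k H H H (d ⊗ₜ[k] z)) *
          ((1 : H) ⊗ₜ[k] Algebra.TensorProduct.assoc k k k H H H (p ⊗ₜ[k] 1))) := by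
    intro d p x z
    induction d with
    | zero => simp
    | add d d' hd hd' =>
      simp only [add_mul, map_add, TensorProduct.add_tmul, TensorProduct.tmul_add, mul_add]
        at hd hd' ⊢
      rw [hd, hd']
    | tmul d₁ d₂ =>
      induction p with
      | zero => simp
      | add d d' hd hd' =>
        simp only [map_add, TensorProduct.add_tmul, TensorProduct.tmul_add, mul_add]
          at hd hd' ⊢
        rw [hd, hd']
      | tmul p₁ p₂ => simp
  induction v with
  | zero => simp
  | add v v' hv hv' => simp only [map_add, add_mul, hv, hv']
  | tmul v₁ v =>
    induction v with
    | zero => simp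
    | add v v' hv hv' => simp only [TensorProduct.tmul_add, map_add, add_mul, hv, hv']
    | tmul v₂ v₃ =>
      rw [mulAux_tmul]
      have : v₂ • actMul k H b c p = actMul k H b c (comul k v₂ * p) := by
        induction p with
        | zero => simp
        | add p p' hp hp' => simp only [map_add, smul_add, mul_add, hp, hp']
        | tmul p₁ p₂ => rw [actMul_tmul, QuasiModuleAlgebra.smul_mul (k := k), actMul_mul_tmul]
      rw [this, key]
      rfl

theorem mulMap_mulAux_left (a b c : A) (l : H) (u : H ⊗[k] (H ⊗[k] H)) :
    mulMap k H A (mulAux k H a b u) (c ⊗ₜ l) =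
      mulAux₃ a b c (E₁ (phi k H) * (D₁ (phiInv k H) * (D₃ u *
        ((1 : H) ⊗ₜ[k] ((1 : H) ⊗ₜ[k] ((1 : H) ⊗ₜ[k] l)))))) := by
  induction u with
  | zero => simp
  | add v v' hv hv' => simp only [map_add, add_mul, mul_add, LinearMap.add_apply, hv, hv']
  | tmul u₁ u =>
    induction u with
    | zero => simp
    | add v v' hv hv' =>
      simp only [TensorProduct.tmul_add, map_add, add_mul, mul_add, LinearMap.add_apply, hv, hv']
    | tmul u₂ u₃ =>
      have h1 : ((u₁ • a) * (u₂ • b)) = actMul k H a b (u₁ ⊗ₜ[k] u₂) := by simp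
      rw [mulAux_tmul, h1]
      change mulAux k H _ c (phiInv k H * (1 ⊗ₜ[k] (comul k u₃ * (1 ⊗ₜ[k] l)))) = _
      rw [mulAux_actMul_left, map_mul D₁, mul_assoc]
      congr 3
      simp [Algebra.TensorProduct.one_def, mul_assoc]

theorem mulMap_mulAux_right (a b c : A) (h : H) (u : H ⊗[k] (H ⊗[k] H)) :
    mulMap k H A (a ⊗ₜ h) (mulAux k H b c u) =
      mulAux₃ a b c (D₂ (phiInv k H) * (D₂ ((1 : H) ⊗ₜ[k] comul k h) *
        ((1 : H) ⊗ₜ[k] u))) := by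
  induction u with
  | zero => simp
  | add v v' hv hv' => simp only [map_add, TensorProduct.tmul_add, mul_add, hv, hv']
  | tmul u₁ u =>
    induction u with
    | zero => simp
    | add v v' hv hv' =>
      simp only [TensorProduct.tmul_add, map_add, mul_add, hv, hv']
    | tmul u₂ u₃ =>
      have h1 : ((u₁ • b) * (u₂ • c)) = actMul k H b c (u₁ ⊗ₜ[k] u₂) := by simp
      rw [mulAux_tmul, h1]
      change mulAux k H a _ (phiInv k H * (1 ⊗ₜ[k] (comul k h * (1 ⊗ₜ[k] u₃)))) = _
      have h2 : ((1 : H) ⊗ₜ[k] (comul k h * (1 ⊗ₜ[k] u₃))) =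
          ((1 : H) ⊗ₜ[k] comul k h) * ((1 : H) ⊗ₜ[k] ((1 : H) ⊗ₜ[k] u₃)) := by simp
      rw [mulAux_actMul_right, map_mul D₂, h2, map_mul D₂, mul_assoc, mul_assoc]
      congr 3
      simp [Algebra.TensorProduct.one_def]

theorem mk_mul_assoc (a b c : A) (h g l : H) :
    mk k H a h * mk k H b g * mk k H c l = mk k H a h * (mk k H b g * mk k H c l) := by
  change mulMap k H A (mulAux k H a b _) (c ⊗ₜ l) = mulMap k H A (a ⊗ₜ h) (mulAux k H b c _)
  rw [mulMap_mulAux_left, mulMap_mulAux_right]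
  congr 1
  have h3 : D₃ (phiInv k H * ((1 : H) ⊗ₜ[k] (comul k h * ((1 : H) ⊗ₜ[k] g)))) *
      ((1 : H) ⊗ₜ[k] ((1 : H) ⊗ₜ[k] ((1 : H) ⊗ₜ[k] l))) =
      D₃ (phiInv k H) * ((1 : H) ⊗ₜ[k]
        (Algebra.TensorProduct.map (AlgHom.id k H) (comul k) (comul k h) *
          ((1 : H) ⊗ₜ[k] (comul k g * ((1 : H) ⊗ₜ[k] l))))) := by
    simp [mul_assoc]
  have h2 : D₂ ((1 : H) ⊗ₜ[k] comul k h) = (1 : H) ⊗ₜ[k]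
      Algebra.TensorProduct.assoc k k k H H H
          (Algebra.TensorProduct.map (comul k) (AlgHom.id k H) (comul k h)) := by simp
  rw [h3, h2, ← mul_assoc, ← mul_assoc, pentagon_inv, mul_assoc]
  congr 1
  simp only [Algebra.TensorProduct.tmul_mul_tmul, mul_one, ← mul_assoc, phiInv_coassoc]

end RingStructure

section Unit

variable {k H}

theorem counit_counit (h : H) :
    Algebra.TensorProduct.lid k k (Algebra.TensorProduct.map (counit k) (counit k) (comul k h)) =
      counit k h := by
  have h1 : ∀ d : H ⊗[k] H,
      Algebra.TensorProduct.lid k k (Algebra.TensorProduct.map (counit k) (counit k) d) =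
        counit k (Algebra.TensorProduct.lid k H
          (Algebra.TensorProduct.map (counit k) (AlgHom.id k H) d)) := by
    intro d
    induction d with
    | zero => simp
    | tmul x y => simp
    | add d d' hd hd' => simp only [map_add, hd, hd']
  rw [h1, QuasiBialgebra.counit_left]

/-- `ε ⊗ I ⊗ I`. -/
noncomputable abbrev L₁ : H ⊗[k] (H ⊗[k] H) →ₐ[k] H ⊗[k] H :=
  (Algebra.TensorProduct.lid k (H ⊗[k] H)).toAlgHom.comp
    (Algebra.TensorProduct.map (counit k) (AlgHom.id k (H ⊗[k] H)))

/-- `I ⊗ ε ⊗ I`. -/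
noncomputable abbrev L₂ : H ⊗[k] (H ⊗[k] H) →ₐ[k] H ⊗[k] H :=
  Algebra.TensorProduct.map (AlgHom.id k H)
    ((Algebra.TensorProduct.lid k H).toAlgHom.comp
      (Algebra.TensorProduct.map (counit k) (AlgHom.id k H)))

/-- `ε ⊗ I`. -/
noncomputable abbrev L₀ : H ⊗[k] H →ₐ[k] H :=
  (Algebra.TensorProduct.lid k H).toAlgHom.comp
    (Algebra.TensorProduct.map (counit k) (AlgHom.id k H))

/-- `ε ⊗ ε ⊗ I ⊗ I`. -/
noncomputable abbrev K : H ⊗[k] (H ⊗[k] (H ⊗[k] H)) →ₐ[k] H ⊗[k] H :=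
  (Algebra.TensorProduct.lid k (H ⊗[k] H)).toAlgHom.comp
    (Algebra.TensorProduct.map (counit k) L₁)

theorem algHom_ext₃ {R : Type*} [Ring R] [Algebra k R] {f g : H ⊗[k] (H ⊗[k] H) →ₐ[k] R}
    (h : ∀ x y z : H, f (x ⊗ₜ (y ⊗ₜ z)) = g (x ⊗ₜ (y ⊗ₜ z))) (w : H ⊗[k] (H ⊗[k] H)) :
    f w = g w := by
  induction w with
  | zero => simp
  | add w w' hw hw' => simp only [map_add, hw, hw']
  | tmul x w =>
    induction w with
    | zero => simp
    | add w w' hw hw' => simp only [TensorProduct.tmul_add, map_add, hw, hw']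
    | tmul y z => exact h x y z

theorem L₁_phi : L₁ (phi k H) = 1 := by
  have hp : D₃ (phi k H) * D₁ (phi k H) =
      ((1 : H) ⊗ₜ[k] phi k H) * D₂ (phi k H) * E₁ (phi k H) := QuasiBialgebra.pentagon
  have hm : L₂ (phi k H) = 1 := QuasiBialgebra.counit_associator
  have e1 : K (D₁ (phi k H)) = L₁ (phi k H) := by
    refine algHom_ext₃ (f := K.comp D₁) (g := L₁) (fun x y z => ?_) _
    have : ∀ d : H ⊗[k] H, K (Algebra.TensorProduct.assoc k k k H H (H ⊗[k] H)
        (d ⊗ₜ[k] (y ⊗ₜ[k] z))) = (Algebra.TensorProduct.lid k k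
          (Algebra.TensorProduct.map (counit k) (counit k) d)) • (y ⊗ₜ[k] z) := by
      intro d
      induction d with
      | zero => simp
      | tmul x y => simp [smul_smul, mul_comm]
      | add d d' hd hd' => simp only [TensorProduct.add_tmul, map_add, add_smul, hd, hd']
    exact (this (comul k x)).trans (by rw [counit_counit]; simp)
  have e2 : K (D₂ (phi k H)) = L₁ (phi k H) := by
    refine algHom_ext₃ (f := K.comp D₂) (g := L₁) (fun x y z => ?_) _
    have : ∀ d : H ⊗[k] H, K (x ⊗ₜ[k] Algebra.TensorProduct.assoc k k k H H H
        (d ⊗ₜ[k] z)) = counit k x • ((L₀ d) ⊗ₜ[k] z) := by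
      intro d
      induction d with
      | zero => simp
      | tmul x y => simp [TensorProduct.smul_tmul']
      | add d d' hd hd' =>
        simp only [TensorProduct.add_tmul, TensorProduct.tmul_add, map_add, smul_add, hd, hd']
    exact (this (comul k y)).trans (by
      rw [show L₀ (comul k y) = y from QuasiBialgebra.counit_left y]; simp)
  have e3 : K (D₃ (phi k H)) = 1 := by
    have := algHom_ext₃ (f := K.comp D₃) (g := (comul k).comp (L₀.comp L₂))
      (fun x y z => by simp) (phi k H)
    simp only [AlgHom.comp_apply] at this hm ⊢
    rw [this, hm]; simp
  have e4 : K (E₁ (phi k H)) = 1 := by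
    have := algHom_ext₃ (f := K.comp E₁)
      (g := (Algebra.TensorProduct.includeLeft : H →ₐ[k] H ⊗[k] H).comp (L₀.comp L₂))
      (fun x y z => by simp [TensorProduct.smul_tmul', smul_smul, mul_comm]) (phi k H)
    simp only [AlgHom.comp_apply] at this hm ⊢
    rw [this, hm]; simp [Algebra.TensorProduct.one_def]
  have e5 : K ((1 : H) ⊗ₜ[k] phi k H) = L₁ (phi k H) := by simp
  have h := congrArg K hp
  rw [map_mul, map_mul, map_mul, e1, e2, e3, e4, e5, one_mul, mul_one] at h
  have hi : L₁ (phi k H) * L₁ (phiInv k H) = 1 := by rw [← map_mul, phi_mul_phiInv, map_one]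
  have := congrArg (· * L₁ (phiInv k H)) h
  simp only [mul_assoc, hi, mul_one] at this
  exact this.symm

theorem L₁_phiInv : L₁ (phiInv k H) = 1 := by
  have hi : L₁ (phi k H) * L₁ (phiInv k H) = 1 := by rw [← map_mul, phi_mul_phiInv, map_one]
  rwa [L₁_phi, one_mul] at hi

theorem L₂_phiInv : L₂ (phiInv k H) = 1 := by
  have hi : L₂ (phi k H) * L₂ (phiInv k H) = 1 := by rw [← map_mul, phi_mul_phiInv, map_one]
  rwa [show L₂ (phi k H) = 1 from QuasiBialgebra.counit_associator, one_mul] at hi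

variable {A} [QuasiModuleAlgebra k H A]

theorem mulAux_one_left (b : A) (w : H ⊗[k] (H ⊗[k] H)) :
    mulAux k H 1 b w = TensorProduct.map (orbit k H b) LinearMap.id (L₁ w) := by
  induction w with
  | zero => simp
  | add w w' hw hw' => simp only [map_add, hw, hw']
  | tmul x w =>
    induction w with
    | zero => simp
    | add w w' hw hw' => simp only [TensorProduct.tmul_add, map_add, hw, hw']
    | tmul y z =>
      simp [QuasiModuleAlgebra.smul_one (k := k), TensorProduct.smul_tmul']

theorem mulAux_one_right (a : A) (w : H ⊗[k] (H ⊗[k] H)) :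
    mulAux k H a 1 w = TensorProduct.map (orbit k H a) LinearMap.id (L₂ w) := by
  induction w with
  | zero => simp
  | add w w' hw hw' => simp only [map_add, hw, hw']
  | tmul x w =>
    induction w with
    | zero => simp
    | add w w' hw hw' => simp only [TensorProduct.tmul_add, map_add, hw, hw']
    | tmul y z =>
      simp [QuasiModuleAlgebra.smul_one (k := k), TensorProduct.smul_tmul', mul_smul_comm]

theorem one_mul_mk (b : A) (g : H) : 1 * mk k H b g = mk k H b g := by
  change mulAux k H 1 b (phiInv k H * (1 ⊗ₜ[k] (comul k 1 * (1 ⊗ₜ[k] g)))) = b ⊗ₜ g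
  rw [mulAux_one_left, map_mul, L₁_phiInv]
  simp

theorem mk_mul_one (a : A) (h : H) : mk k H a h * 1 = mk k H a h := by
  change mulAux k H a 1 (phiInv k H * (1 ⊗ₜ[k] (comul k h * (1 ⊗ₜ[k] 1)))) = a ⊗ₜ h
  rw [mulAux_one_right, map_mul, L₂_phiInv, ← Algebra.TensorProduct.one_def, mul_one, one_mul,
    Algebra.TensorProduct.map_tmul, AlgHom.comp_apply]
  change TensorProduct.map (orbit k H a) LinearMap.id (1 ⊗ₜ[k] L₀ (comul k h)) = a ⊗ₜ h
  rw [show L₀ (comul k h) = h from QuasiBialgebra.counit_left h]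
  simp

end Unit

section Instances

variable {k H A} in
theorem induction_on {motive : SmashProduct k H A → Prop} (x : SmashProduct k H A)
    (zero : motive 0) (mk : ∀ (a : A) (h : H), motive (mk k H a h))
    (add : ∀ x y, motive x → motive y → motive (x + y)) : motive x :=
  TensorProduct.induction_on x zero mk add

variable [QuasiModuleAlgebra k H A]

/-- `A # H` is an associative ring with unit `1 # 1`. -/
noncomputable instance : Ring (SmashProduct k H A) where
  left_distrib x y z := map_add (mulMap k H A x) y z
  right_distrib x y z := LinearMap.map_add₂ (mulMap k H A) x y z
  zero_mul x := LinearMap.map_zero₂ (mulMap k H A) x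
  mul_zero x := map_zero (mulMap k H A x)
  mul_assoc x y z := by
    have add_l : ∀ u v w : SmashProduct k H A, (u + v) * w = u * w + v * w :=
      fun u v w => LinearMap.map_add₂ (mulMap k H A) u v w
    have add_r : ∀ u v w : SmashProduct k H A, u * (v + w) = u * v + u * w :=
      fun u v w => map_add (mulMap k H A u) v w
    have zero_l : ∀ u : SmashProduct k H A, 0 * u = 0 := fun u =>
      LinearMap.map_zero₂ (mulMap k H A) u
    have zero_r : ∀ u : SmashProduct k H A, u * 0 = 0 := fun u => map_zero (mulMap k H A u)
    induction x using induction_on with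
    | zero => simp only [zero_l]
    | add x x' hx hx' => simp only [add_l, hx, hx']
    | mk a h =>
      induction y using induction_on with
      | zero => simp only [zero_l, zero_r]
      | add x x' hx hx' => simp only [add_l, add_r, hx, hx']
      | mk b g =>
        induction z using induction_on with
        | zero => simp only [zero_r]
        | add x x' hx hx' => simp only [add_r, hx, hx']
        | mk c l => exact mk_mul_assoc a b c h g l
  one_mul x := by
    induction x using induction_on with
    | zero => exact map_zero (mulMap k H A _)
    | add x x' hx hx' => exact (map_add (mulMap k H A _) x x').trans (congrArg₂ _ hx hx')
    | mk a h => exact one_mul_mk a h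
  mul_one x := by
    induction x using induction_on with
    | zero => exact LinearMap.map_zero₂ (mulMap k H A) _
    | add x x' hx hx' =>
      exact (LinearMap.map_add₂ (mulMap k H A) x x' _).trans (congrArg₂ _ hx hx')
    | mk a h => exact mk_mul_one a h
  neg_add_cancel x := neg_add_cancel x
  zsmul := fun n x => n • x
  zsmul_zero' x := zero_zsmul x
  zsmul_succ' n x := SubNegMonoid.zsmul_succ' n x
  zsmul_neg' n x := SubNegMonoid.zsmul_neg' n x
  sub_eq_add_neg := sub_eq_add_neg

noncomputable instance : Algebra k (SmashProduct k H A) :=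
  Algebra.ofModule
    (fun c x y => LinearMap.map_smul₂ (mulMap k H A) c x y)
    (fun c x y => map_smul (mulMap k H A x) c y)

end Instances


section LeftAction

variable [QuasiModuleAlgebra k H A]

/-- The action `(a # h) b = a (h · b)` of `A # H` on `A`. -/
noncomputable def smulMap : A ⊗[k] H →ₗ[k] A →ₗ[k] A :=
  TensorProduct.lift (LinearMap.mk₂ k
    (fun a h => LinearMap.mulLeft k a ∘ₗ (Algebra.lsmul k k A h : A →ₗ[k] A))
    (fun a a' h => by ext b; simp [add_mul])
    (fun c a h => by ext b; simp [smul_mul_assoc])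
    (fun a h h' => by ext b; simp [mul_add])
    (fun c a h => by ext b; simp))

noncomputable instance : SMul (SmashProduct k H A) A := ⟨fun x b => smulMap k H A x b⟩

variable {k H A} in
theorem mk_smul (a b : A) (h : H) : mk k H a h • b = a * (h • b) := rfl

variable {k H A} in
theorem mulAux_smul (a b c : A) (w : H ⊗[k] (H ⊗[k] H)) :
    smulMap k H A (mulAux k H a b w) c = actMulMul k H a b c (phi k H * w) := by
  induction w with
  | zero => simp
  | add w w' hw hw' => simp only [map_add, LinearMap.add_apply, mul_add, hw, hw']
  | tmul x w =>
    induction w with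
    | zero => simp
    | add w w' hw hw' =>
      simp only [TensorProduct.tmul_add, map_add, LinearMap.add_apply, mul_add, hw, hw']
    | tmul y z =>
      rw [mulAux_tmul, actMulMul_mul_tmul, ← QuasiModuleAlgebra.mul_mul]
      rfl

/-- `A` is a left `A # H`-module via `(a # h) b = a (h · b)`. -/
noncomputable instance : Module (SmashProduct k H A) A where
  one_smul b := by
    change (1 : A) * ((1 : H) • b) = b
    simp
  mul_smul x y c := by
    have add_s : ∀ (u v : SmashProduct k H A) (c : A), (u + v) • c = u • c + v • c :=
      fun u v c => LinearMap.map_add₂ (smulMap k H A) u v c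
    have s_add : ∀ (u : SmashProduct k H A) (c d : A), u • (c + d) = u • c + u • d :=
      fun u c d => map_add (smulMap k H A u) c d
    have zero_s : ∀ c : A, (0 : SmashProduct k H A) • c = 0 :=
      fun c => LinearMap.map_zero₂ (smulMap k H A) c
    have s_zero : ∀ u : SmashProduct k H A, u • (0 : A) = 0 := fun u => map_zero (smulMap k H A u)
    induction x using induction_on with
    | zero => simp only [zero_mul, zero_s]
    | add x x' hx hx' => simp only [add_mul, add_s, hx, hx']
    | mk a h =>
      induction y using induction_on with
      | zero => simp only [mul_zero, zero_s, s_zero]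
      | add x x' hx hx' => simp only [mul_add, add_s, s_add, hx, hx']
      | mk b g =>
        change smulMap k H A (mulAux k H a b _) c = a * (h • (b * (g • c)))
        rw [mulAux_smul, ← mul_assoc, phi_mul_phiInv, one_mul, actMulMul_tmul, one_smul,
          actMul_mul_tmul, one_smul, QuasiModuleAlgebra.smul_mul (k := k)]
  smul_zero u := map_zero (smulMap k H A u)
  smul_add u c d := map_add (smulMap k H A u) c d
  add_smul u v c := LinearMap.map_add₂ (smulMap k H A) u v c
  zero_smul c := LinearMap.map_zero₂ (smulMap k H A) c

end LeftAction

/-- `(A # H)^H`, the elements `x` of `A # H` with `(1 # h) x = ε(h) x` for all `h`. -/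
def invariants [QuasiModuleAlgebra k H A] : Set (SmashProduct k H A) :=
  {x | ∀ h : H, mk k H 1 h * x = counit k h • x}

end SmashProduct

section Invariants

variable [QuasiBialgebra k H]

/-- `A^H = {a | h · a = ε(h) a for all h}`. -/
def invariants : Submodule k A where
  carrier := {a | ∀ h : H, h • a = counit k h • a}
  add_mem' ha hb h := by rw [smul_add, ha h, hb h, smul_add]
  zero_mem' h := by rw [smul_zero, smul_zero]
  smul_mem' c a ha h := by
    have := IsScalarTower.to_smulCommClass (R := k) (A := H) (M := A)
    rw [smul_comm h c a, ha h, smul_comm]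

variable {k H A}

theorem actMul_invariants {a b : A} (ha : a ∈ invariants k H A) (p : H ⊗[k] H) :
    actMul k H a b p = a * (SmashProduct.L₀ p • b) := by
  induction p with
  | zero => simp
  | tmul x y => rw [actMul_tmul, ha x]; simp [smul_mul_assoc, mul_smul_comm]
  | add p p' hp hp' => simp only [map_add, add_smul, mul_add, hp, hp']

variable [QuasiModuleAlgebra k H A]

theorem mul_assoc_of_left {a : A} (ha : a ∈ invariants k H A) (b c : A) :
    (a * b) * c = a * (b * c) := by
  have : ∀ w, actMulMul k H a b c w = a * actMul k H b c (SmashProduct.L₁ w) := by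
    intro w
    induction w with
    | zero => simp
    | tmul x p => rw [actMulMul_tmul, ha x]; simp [smul_mul_assoc, mul_smul_comm]
    | add p p' hp hp' => simp only [map_add, mul_add, hp, hp']
  rw [QuasiModuleAlgebra.mul_mul (k := k) (H := H), this, SmashProduct.L₁_phi,
    Algebra.TensorProduct.one_def, actMul_tmul, one_smul, one_smul]

theorem mul_assoc_of_middle {b : A} (hb : b ∈ invariants k H A) (a c : A) :
    (a * b) * c = a * (b * c) := by
  have key : ∀ w : H ⊗[k] (H ⊗[k] H), actMulMul k H a b c w =
      LinearMap.mul' k A (TensorProduct.map (orbit k H a)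
        (LinearMap.mulLeft k b ∘ₗ orbit k H c) (SmashProduct.L₂ w)) := by
    intro w
    induction w with
    | zero => simp
    | tmul x p => rw [actMulMul_tmul, actMul_invariants hb]; simp
    | add p p' hp hp' => simp only [map_add, hp, hp']
  rw [QuasiModuleAlgebra.mul_mul (k := k) (H := H), key,
    show SmashProduct.L₂ (phi k H) = 1 from QuasiBialgebra.counit_associator]
  simp [Algebra.TensorProduct.one_def]

theorem one_mem_invariants : (1 : A) ∈ invariants k H A := QuasiModuleAlgebra.smul_one

theorem mul_mem_invariants {a b : A} (ha : a ∈ invariants k H A) (hb : b ∈ invariants k H A) :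
    a * b ∈ invariants k H A := fun h => by
  rw [QuasiModuleAlgebra.smul_mul (k := k), actMul_invariants ha,
    show SmashProduct.L₀ (comul k h) = h from QuasiBialgebra.counit_left h, hb h, mul_smul_comm]

variable (k H A)

instance : Mul (invariants k H A) := ⟨fun a b => ⟨a.1 * b.1, mul_mem_invariants a.2 b.2⟩⟩

instance : One (invariants k H A) := ⟨⟨1, one_mem_invariants⟩⟩

/-- `A^H` is an associative ring, with the multiplication of `A`. -/
noncomputable instance : Ring (invariants k H A) where
  left_distrib _ _ _ := Subtype.ext (mul_add _ _ _)
  right_distrib _ _ _ := Subtype.ext (add_mul _ _ _)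
  zero_mul _ := Subtype.ext (zero_mul _)
  mul_zero _ := Subtype.ext (mul_zero _)
  mul_assoc a b c := Subtype.ext (mul_assoc_of_left a.2 b.1 c.1)
  one_mul _ := Subtype.ext (one_mul _)
  mul_one _ := Subtype.ext (mul_one _)
  neg_add_cancel x := neg_add_cancel x
  zsmul := fun n x => n • x
  zsmul_zero' x := zero_zsmul x
  zsmul_succ' n x := SubNegMonoid.zsmul_succ' n x
  zsmul_neg' n x := SubNegMonoid.zsmul_neg' n x
  sub_eq_add_neg := sub_eq_add_neg

noncomputable instance : Algebra k (invariants k H A) :=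
  Algebra.ofModule (fun _ _ _ => Subtype.ext (smul_mul_assoc _ _ _))
    (fun _ _ _ => Subtype.ext (mul_smul_comm _ _ _))

/-- `A` is a left `A^H`-module by multiplication in `A`. -/
instance : Module (invariants k H A) A where
  smul b a := b.1 * a
  one_smul a := one_mul a
  mul_smul b c a := mul_assoc_of_left b.2 c.1 a
  smul_zero b := mul_zero b.1
  smul_add b := mul_add b.1
  add_smul b c := add_mul b.1 c.1
  zero_smul a := zero_mul a

/-- `A` is a right `A^H`-module by multiplication in `A`. -/
instance : Module (invariants k H A)ᵐᵒᵖ A where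
  smul b a := a * b.unop.1
  one_smul a := mul_one a
  mul_smul b c a := (mul_assoc_of_middle c.unop.2 a b.unop.1).symm
  smul_zero b := zero_mul b.unop.1
  smul_add b a a' := add_mul a a' b.unop.1
  add_smul b c a := mul_add a b.unop.1 c.unop.1
  zero_smul a := mul_zero a

end Invariants

section Morita

variable {A} [QuasiHopfAlgebra k H] [QuasiModuleAlgebra k H A]

/-- `φ(h ⊗ a) = h₁ p_L¹ · a # h₂ p_L²`. -/
noncomputable def varphi (h : H) (a : A) : SmashProduct k H A :=
  TensorProduct.map (orbit k H a) LinearMap.id (comul k h * pL k H)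

/-- The map `(a, x) ↦ a ·_γ x` given by
`a ·_γ (b # h) = S⁻¹(S(X²) Λ (γ ⇀ X³ h)) · [(p_L¹ S⁻¹(X¹) · a)(p_L² · b)]`, where
`φ = X¹ ⊗ X² ⊗ X³`. -/
noncomputable def gammaAction (a : A) : SmashProduct k H A →ₗ[k] A :=
  TensorProduct.lift (LinearMap.mk₂ k
    (fun b h => TensorProduct.lift (Algebra.lsmul k k A : H →ₐ[k] Module.End k A).toLinearMap.flip
      (TensorProduct.map
        (actMul k H a b ∘ₗ LinearMap.mulLeft k (pL k H) ∘ₗ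
          (TensorProduct.mk k H H).flip 1 ∘ₗ antipodeInv k H)
        (antipodeInv k H ∘ₗ LinearMap.mul' k H ∘ₗ
          TensorProduct.map (antipode k)
            (LinearMap.mulLeft k (Lam k H) ∘ₗ gammaHarpoon k H ∘ₗ LinearMap.mulRight k h))
        (phi k H)))
    (fun b b' h => by
      simp only [actMul_add_right, LinearMap.add_comp, TensorProduct.map_add_left,
        LinearMap.add_apply, map_add])
    (fun c b h => by
      simp only [actMul_smul_right, LinearMap.smul_comp, TensorProduct.map_smul_left,
        LinearMap.smul_apply, map_smul])
    (fun b h h' => by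
      have : LinearMap.mulRight k (h + h') = LinearMap.mulRight k h + LinearMap.mulRight k h' := by
        ext; simp [mul_add]
      simp only [this, LinearMap.comp_add, TensorProduct.map_add_right, LinearMap.add_apply,
        map_add])
    (fun c b h => by
      have : LinearMap.mulRight k (c • h) = c • LinearMap.mulRight k h := by ext; simp
      simp only [this, LinearMap.comp_smul, TensorProduct.map_smul_right, LinearMap.smul_apply,
        map_smul]))

/-- The map `(a, b) = t · [(p_L¹ · a)(p_L² · b)]`, with values in `A^H`. -/
noncomputable def roundMap (t : H) (ht : IsLeftIntegral k t) : A →ₗ[k] A →ₗ[k] invariants k H A :=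
  have : SMulCommClass k H A := IsScalarTower.to_smulCommClass
  LinearMap.mk₂ k
    (fun a b => ⟨t • actMul k H a b (pL k H), fun h => by
      rw [← mul_smul, ht h, smul_assoc]⟩)
    (fun a a' b => Subtype.ext (by
      simp only [actMul_add_left, LinearMap.add_apply, smul_add, Submodule.coe_add]))
    (fun c a b => Subtype.ext (by
      simp only [actMul_smul_left, LinearMap.smul_apply, smul_comm t c, Submodule.coe_smul]))
    (fun a b b' => Subtype.ext (by
      simp only [actMul_add_right, LinearMap.add_apply, smul_add, Submodule.coe_add]))
    (fun c a b => Subtype.ext (by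
      simp only [actMul_smul_right, LinearMap.smul_apply, smul_comm t c, Submodule.coe_smul]))

/-- The element `p_L¹ · b # p_L²`. -/
noncomputable def pLSmash (b : A) : SmashProduct k H A :=
  TensorProduct.map (orbit k H b) LinearMap.id (pL k H)

/-- The map `[a, b] = (a # t)(p_L¹ · b # p_L²)`. -/
noncomputable def squareMap (t : H) : A →ₗ[k] A →ₗ[k] SmashProduct k H A :=
  LinearMap.mk₂ k
    (fun a b => SmashProduct.mk k H a t * pLSmash k H b)
    (fun a a' b => by
      rw [← add_mul]; congr 1; exact TensorProduct.add_tmul a a' t)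
    (fun c a b => by
      rw [← smul_mul_assoc]; congr 1)
    (fun a b b' => by
      rw [← mul_add]; simp only [pLSmash, orbit_add, TensorProduct.map_add_left]; rfl)
    (fun c a b => by
      rw [← mul_smul_comm]; simp only [pLSmash, orbit_smul, TensorProduct.map_smul_left]; rfl)

end Morita

end QuasiHopf

/-- `(R, S, P, Q, (-,-), [-,-])` is a Morita context of `k`-algebras: `P` is an `R`-`S`-bimodule,
`Q` is an `S`-`R`-bimodule, `(-,-) : Q ⊗_R P → S` and `[-,-] : P ⊗_S Q → R` are bimodule maps, and
`[p, q] p' = p (q, p')` and `(q, p) q' = q [p, q']`. Right actions are actions of the opposite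
ring, and maps on `Q ⊗_R P` and `P ⊗_S Q` are given as balanced bilinear maps. -/
structure IsMoritaContext (k R S P Q : Type*) [Field k] [Ring R] [Algebra k R] [Ring S]
    [Algebra k S] [AddCommGroup P] [Module k P] [AddCommGroup Q] [Module k Q]
    [Module R P] [Module Sᵐᵒᵖ P] [Module S Q] [Module Rᵐᵒᵖ Q]
    (round : Q →ₗ[k] P →ₗ[k] S) (square : P →ₗ[k] Q →ₗ[k] R) : Prop where
  algebraMap_smul_left_P : ∀ (c : k) (p : P), algebraMap k R c • p = c • p
  algebraMap_smul_right_P : ∀ (c : k) (p : P), op (algebraMap k S c) • p = c • p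
  algebraMap_smul_left_Q : ∀ (c : k) (q : Q), algebraMap k S c • q = c • q
  algebraMap_smul_right_Q : ∀ (c : k) (q : Q), op (algebraMap k R c) • q = c • q
  bimodule_P : ∀ (r : R) (s : S) (p : P), r • (op s • p) = op s • (r • p)
  bimodule_Q : ∀ (s : S) (r : R) (q : Q), s • (op r • q) = op r • (s • q)
  round_balanced : ∀ (q : Q) (r : R) (p : P), round (op r • q) p = round q (r • p)
  round_left : ∀ (s : S) (q : Q) (p : P), round (s • q) p = s * round q p
  round_right : ∀ (q : Q) (p : P) (s : S), round q (op s • p) = round q p * s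
  square_balanced : ∀ (p : P) (s : S) (q : Q), square (op s • p) q = square p (s • q)
  square_left : ∀ (r : R) (p : P) (q : Q), square (r • p) q = r * square p q
  square_right : ∀ (p : P) (q : Q) (r : R), square p (op r • q) = square p q * r
  square_round : ∀ (p : P) (q : Q) (p' : P), square p q • p' = op (round q p') • p
  round_square : ∀ (q : Q) (p : P) (q' : Q), round q p • q' = op (square p q') • q

/-! For a left `H`-module `V`, the map `h ⊗ v ↦ h₁p_L¹·v ⊗ h₂p_L²` is a bijection `H ⊗ V → V ⊗ H`
that turns left multiplication on the factor `H` into the diagonal action through `Δ`. Its inverse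
is `v ⊗ h ↦ q_L²h₂ ⊗ S⁻¹(q_L¹h₁)·v` (`diagonalInv_diagonalMap`, `diagonalMap_diagonalInv`). This
rests on two identities between `p_L` and `q_L` (`qLTwist_pL`, `pLTwist_qL`), each read off from the
pentagon by contracting three of its four legs with `S`, `α`, `β`.

The bijection needs `S⁻¹`, so injectivity of `S` is proved beforehand from the integral
(`antipode_injective`). Since `(1 ⊗ h)q_LΔ(t) = (S(h) ⊗ 1)q_LΔ(t)` and `(β ⊗ 1)q_LΔ(t) = Δ(t)`, the
ideal `ker S` kills the second leg of `Δ(t)`; coassociativity then gives `t ⊗ i = 0` for `i ∈ ker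
S`.

Taking `V = H*` bounds the space of left integrals: its tensor product with `H*` embeds in `H`, so
its dimension is at most one (`finrank_leftIntegrals_le_one`). As `th` is again a left integral, it
is a multiple of `t`, and the factor is `γ(h)`.

Taking `V = A` gives a bijection `H ⊗ A → A # H` compatible with left multiplication by `1 # g`, so
the invariants of `A # H` correspond to (integrals) `⊗ A = t ⊗ A` (`exists_varphi_eq`). The same
compatibility gives `(1 # t)φ(h ⊗ a) = φ(th ⊗ a) = γ(h)φ(t ⊗ a)`. Hence `(1 # t)x` is `φ(t ⊗ -)` of
the element obtained by applying `γ ⊗ I` to the preimage of `x`. Since `φ(t ⊗ a) = (1 # t)(p_L¹·a #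
p_L²)`, this computes `φ(t ⊗ a)x` and produces the formula for `·_γ` (`modularCollapse_pLSmash_mul`,
`varphi_gammaAction`).

Finally `(a, b) = φ(t ⊗ a)·b` and `[a, b] = (a # 1)φ(t ⊗ b)`. The Morita identities then reduce to
associativity in `A # H`, to linearity of `φ(h ⊗ -)` over `A^H`, and to `((x·a) # 1)y = x(a # 1)y`
for invariant `y` (`mk_smul_one_mul`). Identities inside `A` are checked after the injective map
`φ(t ⊗ -)` when they involve `·_γ`. -/

namespace QuasiHopf

open SmashProduct (D₁ D₂ D₃ E₁ L₁ L₂ L₀ phi_mul_phiInv phiInv_mul_phi phiInv_coassoc L₁_phi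
  L₁_phiInv L₂_phiInv)

/-! ### Counit contractions of the associator -/

section Contractions

variable {k H : Type*} [Field k] [Ring H] [Algebra k H]

theorem induction₃ {motive : H ⊗[k] (H ⊗[k] H) → Prop} (w : H ⊗[k] (H ⊗[k] H)) (zero : motive 0)
    (tmul : ∀ x y z, motive (x ⊗ₜ (y ⊗ₜ z)))
    (add : ∀ v w, motive v → motive w → motive (v + w)) : motive w := by
  induction w with
  | zero => exact zero
  | add v w hv hw => exact add v w hv hw
  | tmul x d =>
    induction d with
    | zero => rwa [TensorProduct.tmul_zero]
    | add v w hv hw => rw [TensorProduct.tmul_add]; exact add _ _ hv hw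
    | tmul y z => exact tmul x y z

theorem induction₄ {motive : H ⊗[k] (H ⊗[k] (H ⊗[k] H)) → Prop}
    (w : H ⊗[k] (H ⊗[k] (H ⊗[k] H))) (zero : motive 0)
    (tmul : ∀ x y z u, motive (x ⊗ₜ (y ⊗ₜ (z ⊗ₜ u))))
    (add : ∀ v w, motive v → motive w → motive (v + w)) : motive w := by
  induction w with
  | zero => exact zero
  | add v w hv hw => exact add v w hv hw
  | tmul x d =>
    induction d using induction₃ with
    | zero => rwa [TensorProduct.tmul_zero]
    | add v w hv hw => rw [TensorProduct.tmul_add]; exact add _ _ hv hw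
    | tmul y z u => exact tmul x y z u

variable (k H) in
/-- The rebracketing `x ⊗ (y ⊗ (z ⊗ u)) ↦ (x ⊗ (y ⊗ z)) ⊗ u`. -/
noncomputable def rebracket : H ⊗[k] (H ⊗[k] (H ⊗[k] H)) →ₗ[k] (H ⊗[k] (H ⊗[k] H)) ⊗[k] H :=
  (TensorProduct.assoc k H (H ⊗[k] H) H).symm.toLinearMap ∘ₗ
    TensorProduct.map LinearMap.id (TensorProduct.assoc k H H H).symm.toLinearMap

@[simp] theorem rebracket_tmul (x y z u : H) :
    rebracket k H (x ⊗ₜ (y ⊗ₜ (z ⊗ₜ u))) = (x ⊗ₜ (y ⊗ₜ z)) ⊗ₜ u := rfl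

/-- `I ⊗ I ⊗ ε`. -/
noncomputable abbrev L₃ [QuasiBialgebra k H] : H ⊗[k] (H ⊗[k] H) →ₐ[k] H ⊗[k] H :=
  Algebra.TensorProduct.map (AlgHom.id k H)
    ((Algebra.TensorProduct.rid k k H).toAlgHom.comp
      (Algebra.TensorProduct.map (AlgHom.id k H) (counit k)))

/-- `I ⊗ ε`. -/
noncomputable abbrev R₀ [QuasiBialgebra k H] : H ⊗[k] H →ₐ[k] H :=
  (Algebra.TensorProduct.rid k k H).toAlgHom.comp
    (Algebra.TensorProduct.map (AlgHom.id k H) (counit k))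

theorem R₀_comul [QuasiBialgebra k H] (h : H) : R₀ (comul k h) = h := QuasiBialgebra.counit_right h

theorem L₀_comul [QuasiBialgebra k H] (h : H) : L₀ (comul k h) = h := QuasiBialgebra.counit_left h

theorem L₂_phi [QuasiBialgebra k H] : L₂ (phi k H) = 1 := QuasiBialgebra.counit_associator

/-- `I ⊗ I ⊗ ε ⊗ ε`. -/
noncomputable abbrev counitThreeFour [QuasiBialgebra k H] :
    H ⊗[k] (H ⊗[k] (H ⊗[k] H)) →ₐ[k] H ⊗[k] H :=
  Algebra.TensorProduct.map (AlgHom.id k H) (R₀.comp L₃)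

/-- Applying `ε` to the last two legs of the pentagon turns the factors `D₁` and `1 ⊗ φ` into `1`
(both by the axiom on the middle leg) and the three others into `L₃ φ`. So `L₃ φ` is an invertible
idempotent. -/
theorem L₃_phi [QuasiBialgebra k H] : L₃ (phi k H) = 1 := by
  have hp : D₃ (phi k H) * D₁ (phi k H) =
      ((1 : H) ⊗ₜ[k] phi k H) * D₂ (phi k H) * E₁ (phi k H) := QuasiBialgebra.pentagon
  have hm : L₂ (phi k H) = 1 := L₂_phi
  have e3 : counitThreeFour (D₃ (phi k H)) = L₃ (phi k H) := by
    refine SmashProduct.algHom_ext₃ (f := counitThreeFour.comp D₃) (g := L₃) (fun x y z => ?_) _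
    have : ∀ d : H ⊗[k] H, counitThreeFour (x ⊗ₜ[k] (y ⊗ₜ[k] d)) =
        (counit k (L₀ d)) • (x ⊗ₜ[k] y) := by
      intro d
      induction d with
      | zero => simp
      | tmul a b => simp [TensorProduct.smul_tmul', smul_smul]
      | add d d' hd hd' => simp only [TensorProduct.tmul_add, map_add, add_smul, hd, hd']
    refine (this (comul k z)).trans ?_
    rw [L₀_comul]; simp
  have e2 : counitThreeFour (D₂ (phi k H)) = L₃ (phi k H) := by
    refine SmashProduct.algHom_ext₃ (f := counitThreeFour.comp D₂) (g := L₃) (fun x y z => ?_) _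
    have : ∀ d : H ⊗[k] H, counitThreeFour (x ⊗ₜ[k] Algebra.TensorProduct.assoc k k k H H H
        (d ⊗ₜ[k] z)) = counit k z • (x ⊗ₜ[k] R₀ d) := by
      intro d
      induction d with
      | zero => simp
      | tmul a b => simp [smul_smul]
      | add d d' hd hd' =>
        simp only [TensorProduct.tmul_add, TensorProduct.add_tmul, map_add, smul_add, hd, hd']
    refine (this (comul k y)).trans ?_
    rw [R₀_comul]; simp
  have e1 : counitThreeFour (D₁ (phi k H)) = 1 := by
    have : counitThreeFour (D₁ (phi k H)) = comul k (R₀ (L₂ (phi k H))) := by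
      refine SmashProduct.algHom_ext₃ (f := counitThreeFour.comp D₁)
        (g := (comul k).comp (R₀.comp L₂)) (fun x y z => ?_) _
      have : ∀ d : H ⊗[k] H, counitThreeFour (Algebra.TensorProduct.assoc k k k H H (H ⊗[k] H)
          (d ⊗ₜ[k] (y ⊗ₜ[k] z))) = (counit k z * counit k y) • d := by
        intro d
        induction d with
        | zero => simp
        | tmul a b => simp [smul_smul]
        | add d d' hd hd' => simp only [TensorProduct.add_tmul, map_add, smul_add, hd, hd']
      refine (this (comul k x)).trans ?_
      simp [smul_smul, mul_comm]
    rw [this, hm]; simp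
  have e0 : counitThreeFour ((1 : H) ⊗ₜ[k] phi k H) = 1 := by
    have : ∀ w : H ⊗[k] (H ⊗[k] H), R₀ (L₃ w) = R₀ (L₂ w) := by
      intro w
      exact SmashProduct.algHom_ext₃ (f := R₀.comp L₃) (g := R₀.comp L₂)
        (fun x y z => by simp [smul_smul, mul_comm]) w
    have h2 : R₀ (L₃ (phi k H)) = 1 := by rw [this, hm, map_one]
    change (1 : H) ⊗ₜ[k] (R₀ (L₃ (phi k H))) = 1
    rw [h2]; rfl
  have e4 : counitThreeFour (E₁ (phi k H)) = L₃ (phi k H) :=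
    SmashProduct.algHom_ext₃ (f := counitThreeFour.comp E₁) (g := L₃)
      (fun x y z => by simp) (phi k H)
  have h := congrArg counitThreeFour hp
  rw [map_mul, map_mul, map_mul, e1, e2, e3, e4, e0, one_mul, mul_one] at h
  have hi : L₃ (phi k H) * L₃ (phiInv k H) = 1 := by rw [← map_mul, phi_mul_phiInv, map_one]
  have := congrArg (· * L₃ (phiInv k H)) h
  simp only [mul_assoc, hi, mul_one] at this
  exact this.symm

theorem L₃_phiInv [QuasiBialgebra k H] : L₃ (phiInv k H) = 1 := by
  have hi : L₃ (phi k H) * L₃ (phiInv k H) = 1 := by rw [← map_mul, phi_mul_phiInv, map_one]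
  rwa [L₃_phi, one_mul] at hi

end Contractions

/-! ### Contractions with `S`, `α`, `β`, and their effect on `Δ(t)` -/

section Antipode

variable {k H : Type*} [Field k] [Ring H] [Algebra k H] [QuasiHopfAlgebra k H]

theorem antipode_mul (g h : H) : antipode k (g * h) = antipode k h * antipode k g :=
  QuasiHopfAlgebra.antipode_mul g h

theorem antipode_one : antipode k (1 : H) = 1 := QuasiHopfAlgebra.antipode_one

variable (k H) in
/-- `x ⊗ y ↦ S(x) α y`. -/
noncomputable def alphaMap : H ⊗[k] H →ₗ[k] H :=
  LinearMap.mul' k H ∘ₗ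
    TensorProduct.map (LinearMap.mulRight k (alpha k H) ∘ₗ antipode k) LinearMap.id

@[simp] theorem alphaMap_tmul (x y : H) :
    alphaMap k H (x ⊗ₜ y) = antipode k x * alpha k H * y := by simp [alphaMap]

theorem alphaMap_comul (h : H) : alphaMap k H (comul k h) = counit k h • alpha k H :=
  QuasiHopfAlgebra.antipode_alpha h

variable (k H) in
/-- `x ⊗ y ↦ x β S(y)`. -/
noncomputable def betaMap : H ⊗[k] H →ₗ[k] H :=
  LinearMap.mul' k H ∘ₗ TensorProduct.map (LinearMap.mulRight k (beta k H)) (antipode k)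

@[simp] theorem betaMap_tmul (x y : H) :
    betaMap k H (x ⊗ₜ y) = x * beta k H * antipode k y := by simp [betaMap]

theorem betaMap_comul (h : H) : betaMap k H (comul k h) = counit k h • beta k H :=
  QuasiHopfAlgebra.beta_antipode h

variable (k H) in
/-- `x ⊗ y ⊗ z ↦ x β S(y) α z`. -/
noncomputable def betaAlphaMap : H ⊗[k] (H ⊗[k] H) →ₗ[k] H :=
  LinearMap.mul' k H ∘ₗ
    TensorProduct.map (LinearMap.mulRight k (beta k H))
      (LinearMap.mul' k H ∘ₗ
        TensorProduct.map (LinearMap.mulRight k (alpha k H) ∘ₗ antipode k) LinearMap.id)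

@[simp] theorem betaAlphaMap_tmul (x y z : H) :
    betaAlphaMap k H (x ⊗ₜ (y ⊗ₜ z)) = x * beta k H * antipode k y * alpha k H * z := by
  simp [betaAlphaMap, mul_assoc]

theorem betaAlphaMap_phi : betaAlphaMap k H (phi k H) = 1 :=
  QuasiHopfAlgebra.associator_beta_alpha

variable (k H) in
/-- `x ⊗ y ⊗ z ↦ S(x) α y β S(z)`. -/
noncomputable def alphaBetaMap : H ⊗[k] (H ⊗[k] H) →ₗ[k] H :=
  LinearMap.mul' k H ∘ₗ
    TensorProduct.map (LinearMap.mulRight k (alpha k H) ∘ₗ antipode k)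
      (LinearMap.mul' k H ∘ₗ TensorProduct.map (LinearMap.mulRight k (beta k H)) (antipode k))

@[simp] theorem alphaBetaMap_tmul (x y z : H) :
    alphaBetaMap k H (x ⊗ₜ (y ⊗ₜ z)) = antipode k x * alpha k H * y * beta k H * antipode k z := by
  simp [alphaBetaMap, mul_assoc]

theorem alphaBetaMap_phiInv : alphaBetaMap k H (phiInv k H) = 1 :=
  QuasiHopfAlgebra.associator_inv_alpha_beta

variable (k H) in
/-- `x ⊗ y ⊗ z ↦ S(x) α y ⊗ z`. -/
noncomputable def qLMap : H ⊗[k] (H ⊗[k] H) →ₗ[k] H ⊗[k] H :=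
  TensorProduct.map (alphaMap k H) LinearMap.id ∘ₗ (TensorProduct.assoc k H H H).symm.toLinearMap

@[simp] theorem qLMap_tmul (x y z : H) :
    qLMap k H (x ⊗ₜ (y ⊗ₜ z)) = (antipode k x * alpha k H * y) ⊗ₜ z := by
  simp [qLMap]

theorem qLMap_phiInv : qLMap k H (phiInv k H) = qL k H := rfl

theorem qLMap_mul_tmul (w : H ⊗[k] (H ⊗[k] H)) (x : H) (d : H ⊗[k] H) :
    qLMap k H (w * (x ⊗ₜ d)) = (antipode k x ⊗ₜ 1) * qLMap k H w * d := by
  induction w using induction₃ with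
  | zero => simp
  | add v w hv hw => simp only [add_mul, mul_add, map_add, hv, hw]
  | tmul a b c =>
    induction d with
    | zero => simp
    | add v w hv hw => simp only [mul_add, TensorProduct.tmul_add, map_add, hv, hw]
    | tmul y z => simp [antipode_mul, mul_assoc]

/-- The inner factor `S(x₁) α x₂` appears between the legs of `w` and collapses to `ε(x) α`. -/
theorem qLMap_comul_tmul_mul (x y : H) (w : H ⊗[k] (H ⊗[k] H)) :
    qLMap k H (Algebra.TensorProduct.assoc k k k H H H (comul k x ⊗ₜ y) * w) =
      counit k x • (((1 : H) ⊗ₜ[k] y) * qLMap k H w) := by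
  induction w using induction₃ with
  | zero => simp
  | add v w hv hw => simp only [mul_add, map_add, smul_add, hv, hw]
  | tmul a b c =>
    have : ∀ d : H ⊗[k] H, qLMap k H (Algebra.TensorProduct.assoc k k k H H H (d ⊗ₜ y) *
        (a ⊗ₜ (b ⊗ₜ c))) = (antipode k a * alphaMap k H d * b) ⊗ₜ (y * c) := by
      intro d
      induction d with
      | zero => simp
      | add v w hv hw => simp only [TensorProduct.add_tmul, map_add, add_mul, mul_add, hv, hw]
      | tmul x y => simp [antipode_mul, mul_assoc]
    rw [this, alphaMap_comul]
    simp [TensorProduct.smul_tmul', mul_assoc]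

variable (k H) in
/-- `d ↦ (S(d₁) ⊗ 1) q_L Δ(d₂)`. -/
noncomputable def qLTwist : H ⊗[k] H →ₗ[k] H ⊗[k] H :=
  TensorProduct.lift (LinearMap.mk₂ k
    (fun x y => (antipode k x ⊗ₜ 1) * qL k H * comul k y)
    (fun x x' y => by simp only [map_add, TensorProduct.add_tmul, add_mul])
    (fun c x y => by
      simp only [map_smul, ← TensorProduct.smul_tmul', smul_mul_assoc])
    (fun x y y' => by simp only [map_add, mul_add])
    (fun c x y => by simp only [map_smul, mul_smul_comm]))

@[simp] theorem qLTwist_tmul (x y : H) :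
    qLTwist k H (x ⊗ₜ y) = (antipode k x ⊗ₜ 1) * qL k H * comul k y := rfl

/-- `(S(h₁) ⊗ 1) q_L Δ(h₂) = (1 ⊗ h) q_L`. -/
theorem qLTwist_comul (h : H) : qLTwist k H (comul k h) = ((1 : H) ⊗ₜ[k] h) * qL k H := by
  have h1 : ∀ d : H ⊗[k] H, qLTwist k H d = qLMap k H (phiInv k H *
      Algebra.TensorProduct.map (AlgHom.id k H) (comul k) d) := by
    intro d
    induction d with
    | zero => simp
    | add v w hv hw => simp only [map_add, mul_add, hv, hw]
    | tmul x y =>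
      rw [Algebra.TensorProduct.map_tmul, qLMap_mul_tmul, qLMap_phiInv]; rfl
  have h2 : ∀ d : H ⊗[k] H, qLMap k H (Algebra.TensorProduct.assoc k k k H H H
      (Algebra.TensorProduct.map (comul k) (AlgHom.id k H) d) * phiInv k H) =
      ((1 : H) ⊗ₜ[k] L₀ d) * qL k H := by
    intro d
    induction d with
    | zero => simp
    | add v w hv hw => simp only [map_add, add_mul, TensorProduct.tmul_add, hv, hw]
    | tmul x y =>
      rw [Algebra.TensorProduct.map_tmul, qLMap_comul_tmul_mul, qLMap_phiInv]; simp
  rw [h1, phiInv_coassoc, h2, L₀_comul]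

theorem qLTwist_mul_tmul (d : H ⊗[k] H) (x y : H) :
    qLTwist k H (d * (x ⊗ₜ y)) = (antipode k x ⊗ₜ 1) * qLTwist k H d * comul k y := by
  induction d with
  | zero => simp
  | add v w hv hw => simp only [map_add, mul_add, add_mul, hv, hw]
  | tmul a b =>
    simp only [Algebra.TensorProduct.tmul_mul_tmul, qLTwist_tmul, antipode_mul, map_mul, mul_assoc]
    rw [← mul_assoc (antipode k x ⊗ₜ[k] (1 : H)), Algebra.TensorProduct.tmul_mul_tmul, mul_one]

theorem qLTwist_comul_mul (h : H) (d : H ⊗[k] H) :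
    qLTwist k H (comul k h * d) = ((1 : H) ⊗ₜ[k] h) * qLTwist k H d := by
  induction d with
  | zero => simp
  | add v w hv hw => simp only [map_add, mul_add, hv, hw]
  | tmul x y =>
    rw [qLTwist_mul_tmul, qLTwist_comul, qLTwist_tmul]
    simp only [← mul_assoc, Algebra.TensorProduct.tmul_mul_tmul, mul_one, one_mul]

variable (k H) in
/-- `x ⊗ y ⊗ z ⊗ u ↦ x β S(y) α z ⊗ u`. -/
noncomputable def betaAlphaMap₄ : H ⊗[k] (H ⊗[k] (H ⊗[k] H)) →ₗ[k] H ⊗[k] H :=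
  TensorProduct.map (betaAlphaMap k H) LinearMap.id ∘ₗ rebracket k H

@[simp] theorem betaAlphaMap₄_tmul (x y z u : H) :
    betaAlphaMap₄ k H (x ⊗ₜ (y ⊗ₜ (z ⊗ₜ u))) =
      (x * beta k H * antipode k y * alpha k H * z) ⊗ₜ u := by
  simp [betaAlphaMap₄]

/-- On the right, legs one and two of `D₁ w` meet around `β` as `x₁ β S(x₂) = ε(x) β`, so only the
counit of the first leg of `w` survives. -/
theorem betaAlphaMap₄_mul_D₁ (v : H ⊗[k] (H ⊗[k] (H ⊗[k] H))) (w : H ⊗[k] (H ⊗[k] H)) :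
    betaAlphaMap₄ k H (v * D₁ w) =
      betaAlphaMap₄ k H (v * ((1 : H) ⊗ₜ[k] ((1 : H) ⊗ₜ[k] L₁ w))) := by
  induction v using induction₄ with
  | zero => simp
  | add v w hv hw => simp only [add_mul, map_add, hv, hw]
  | tmul a b c e =>
    induction w using induction₃ with
    | zero => simp
    | add v w hv hw =>
      simp only [TensorProduct.tmul_add, map_add, mul_add] at hv hw ⊢
      rw [hv, hw]
    | tmul x y z =>
      have : ∀ d : H ⊗[k] H, betaAlphaMap₄ k H ((a ⊗ₜ (b ⊗ₜ (c ⊗ₜ e))) *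
          Algebra.TensorProduct.assoc k k k H H (H ⊗[k] H) (d ⊗ₜ[k] (y ⊗ₜ[k] z))) =
          (a * betaMap k H d * antipode k b * alpha k H * c * y) ⊗ₜ (e * z) := by
        intro d
        induction d with
        | zero => simp
        | add v w hv hw => simp only [TensorProduct.add_tmul, map_add, add_mul, mul_add, hv, hw]
        | tmul x y => simp [antipode_mul, mul_assoc]
      refine (this (comul k x)).trans ?_
      rw [betaMap_comul]
      simp [TensorProduct.smul_tmul', mul_assoc]

/-- On the left, legs two and three of `D₂ w` meet around `α` as `S(y₁) α y₂ = ε(y) α`. -/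
theorem betaAlphaMap₄_D₂_mul (w : H ⊗[k] (H ⊗[k] H)) (v : H ⊗[k] (H ⊗[k] (H ⊗[k] H))) :
    betaAlphaMap₄ k H (D₂ w * v) = L₂ w * betaAlphaMap₄ k H v := by
  induction v using induction₄ with
  | zero => simp
  | add v w hv hw => simp only [mul_add, map_add, hv, hw]
  | tmul a b c e =>
    induction w using induction₃ with
    | zero => simp
    | add v w hv hw => simp only [map_add, add_mul, hv, hw]
    | tmul x y z =>
      have : ∀ d : H ⊗[k] H, betaAlphaMap₄ k H ((x ⊗ₜ[k]
          Algebra.TensorProduct.assoc k k k H H H (d ⊗ₜ[k] z)) * (a ⊗ₜ (b ⊗ₜ (c ⊗ₜ e)))) =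
          (x * a * beta k H * antipode k b * alphaMap k H d * c) ⊗ₜ (z * e) := by
        intro d
        induction d with
        | zero => simp
        | add v w hv hw =>
          simp only [TensorProduct.add_tmul, TensorProduct.tmul_add, map_add, add_mul, mul_add,
            hv, hw]
        | tmul x y => simp [antipode_mul, mul_assoc]
      refine (this (comul k y)).trans ?_
      rw [alphaMap_comul]
      simp [TensorProduct.smul_tmul', mul_assoc]

theorem betaAlphaMap₄_E₁ (w : H ⊗[k] (H ⊗[k] H)) :
    betaAlphaMap₄ k H (E₁ w) = betaAlphaMap k H w ⊗ₜ 1 := by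
  induction w using induction₃ with
  | zero => simp
  | add v w hv hw => simp only [map_add, TensorProduct.add_tmul, hv, hw]
  | tmul x y z => simp

/-- The pentagon solved so that `D₂` stands leftmost and `D₁` rightmost, the positions in which
contractions with `α` and `β` absorb them. -/
theorem D₂_phi_mul_E₁_phi :
    D₂ (phi k H) * E₁ (phi k H) = ((1 : H) ⊗ₜ[k] phiInv k H) * D₃ (phi k H) * D₁ (phi k H) := by
  have hp : D₃ (phi k H) * D₁ (phi k H) =
      ((1 : H) ⊗ₜ[k] phi k H) * D₂ (phi k H) * E₁ (phi k H) := QuasiBialgebra.pentagon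
  have h4 : ((1 : H) ⊗ₜ[k] phiInv k H) * ((1 : H) ⊗ₜ[k] phi k H) = 1 := by
    rw [Algebra.TensorProduct.tmul_mul_tmul, phiInv_mul_phi, one_mul]; rfl
  rw [mul_assoc, hp, ← mul_assoc, ← mul_assoc, h4, one_mul]

/-- `X¹ β S(X²) S(x¹) α x² X³₁ ⊗ x³ X³₂ = 1 ⊗ 1`. -/
theorem betaAlphaMap₄_phiInv_mul_D₃_phi :
    betaAlphaMap₄ k H (((1 : H) ⊗ₜ[k] phiInv k H) * D₃ (phi k H)) = 1 := by
  -- The factors `D₂ φ` and `D₁ φ` become counit contractions of `φ`, hence `1`, and `E₁ φ`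
  -- contributes `X¹ β S(X²) α X³ = 1`.
  have h := congrArg (betaAlphaMap₄ k H) (D₂_phi_mul_E₁_phi (k := k) (H := H))
  rw [betaAlphaMap₄_D₂_mul, L₂_phi, betaAlphaMap₄_E₁, betaAlphaMap_phi, betaAlphaMap₄_mul_D₁,
    L₁_phi, one_mul, ← Algebra.TensorProduct.one_def, ← Algebra.TensorProduct.one_def,
    ← Algebra.TensorProduct.one_def, mul_one] at h
  exact h.symm

theorem betaAlphaMap₄_one_tmul_mul (w : H ⊗[k] (H ⊗[k] H)) (x y : H) (d : H ⊗[k] H) :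
    betaAlphaMap₄ k H (((1 : H) ⊗ₜ[k] w) * (x ⊗ₜ (y ⊗ₜ d))) =
      (betaMap k H (x ⊗ₜ y) ⊗ₜ[k] 1) * (qLMap k H w * d) := by
  induction d with
  | zero => simp
  | add v w hv hw => simp only [map_add, mul_add, TensorProduct.tmul_add, hv, hw]
  | tmul a b =>
    induction w using induction₃ with
    | zero => simp
    | add v w hv hw => simp only [map_add, mul_add, TensorProduct.tmul_add, add_mul, hv, hw]
    | tmul e f g => simp [antipode_mul, mul_assoc]

/-- The third leg of `w'` enters only as `Δ(z)`, next to `Δ(t)`, and `zt = ε(z)t` replaces it by its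
counit. -/
theorem betaAlphaMap₄_one_tmul_mul_D₃ (w w' : H ⊗[k] (H ⊗[k] H)) {t : H}
    (ht : IsLeftIntegral k t) :
    betaAlphaMap₄ k H (((1 : H) ⊗ₜ[k] w) * D₃ w') * comul k t =
      (betaMap k H (L₃ w') ⊗ₜ[k] 1) * qLMap k H w * comul k t := by
  induction w' using induction₃ with
  | zero => simp
  | add v w hv hw =>
    simp only [map_add, mul_add, TensorProduct.add_tmul, add_mul, hv, hw]
  | tmul x y z =>
    change betaAlphaMap₄ k H (((1 : H) ⊗ₜ[k] w) * (x ⊗ₜ (y ⊗ₜ comul k z))) * _ = _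
    rw [betaAlphaMap₄_one_tmul_mul, mul_assoc, mul_assoc, ← map_mul, ht z]
    simp [← TensorProduct.smul_tmul', mul_assoc]

/-- Multiply the contracted pentagon `betaAlphaMap₄_phiInv_mul_D₃_phi` by `Δ(t)`; the integral
removes `X³`, and `L₃ φ = 1` then leaves `β` alone in front of `q_L`. -/
theorem beta_qL_comul {t : H} (ht : IsLeftIntegral k t) :
    (beta k H ⊗ₜ[k] (1 : H)) * qL k H * comul k t = comul k t := by
  have := betaAlphaMap₄_one_tmul_mul_D₃ (phiInv k H) (phi k H) ht
  rw [betaAlphaMap₄_phiInv_mul_D₃_phi, L₃_phi, one_mul, Algebra.TensorProduct.one_def,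
    betaMap_tmul, antipode_one, one_mul, mul_one, qLMap_phiInv] at this
  exact this.symm

/-- By `qLTwist_comul` the left side is `(S(h₁) ⊗ 1) q_L Δ(h₂t)`, where `h₂t = ε(h₂)t`. Thus an
element can be moved across the legs at the cost of an antipode. -/
theorem one_tmul_mul_qL_comul {t : H} (ht : IsLeftIntegral k t) (h : H) :
    ((1 : H) ⊗ₜ[k] h) * (qL k H * comul k t) =
      (antipode k h ⊗ₜ[k] (1 : H)) * (qL k H * comul k t) := by
  have : ∀ d : H ⊗[k] H, qLTwist k H d * comul k t =
      (antipode k (R₀ d) ⊗ₜ[k] (1 : H)) * (qL k H * comul k t) := by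
    intro d
    induction d with
    | zero => simp
    | add v w hv hw => simp only [map_add, TensorProduct.add_tmul, add_mul, hv, hw]
    | tmul x y =>
      rw [qLTwist_tmul, mul_assoc, mul_assoc, ← map_mul, ht y]
      simp [← TensorProduct.smul_tmul']
  rw [← mul_assoc, ← qLTwist_comul, this, R₀_comul]

/-- If `S(h) = 0`, then `t₁ ⊗ h t₂ = 0`. -/
theorem one_tmul_mul_comul_eq_zero {t : H} (ht : IsLeftIntegral k t) {h : H}
    (hh : antipode k h = 0) : ((1 : H) ⊗ₜ[k] h) * comul k t = 0 := by
  rw [← beta_qL_comul ht, mul_assoc, ← mul_assoc, Algebra.TensorProduct.tmul_mul_tmul]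
  have : ((1 * beta k H) ⊗ₜ[k] (h * 1) : H ⊗[k] H) =
      (beta k H ⊗ₜ[k] 1) * ((1 : H) ⊗ₜ[k] h) := by simp
  rw [this, mul_assoc, one_tmul_mul_qL_comul ht, hh]
  simp

end Antipode

/-! ### Bijectivity of the antipode -/

section AntipodeBijective

variable {k H : Type*} [Field k] [Ring H] [Algebra k H] [QuasiHopfAlgebra k H]

/-- `x ⊗ y ⊗ z ↦ x β S(y) h z`. -/
noncomputable def betaMiddleMap (h : H) : H ⊗[k] (H ⊗[k] H) →ₗ[k] H :=
  LinearMap.mul' k H ∘ₗ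
    TensorProduct.map (LinearMap.mulRight k (beta k H))
      (LinearMap.mul' k H ∘ₗ
        TensorProduct.map (LinearMap.mulRight k h ∘ₗ antipode k) LinearMap.id)

@[simp] theorem betaMiddleMap_tmul (h x y z : H) :
    betaMiddleMap (k := k) h (x ⊗ₜ (y ⊗ₜ z)) = x * beta k H * antipode k y * h * z := by
  simp [betaMiddleMap, mul_assoc]

variable (k H) in
/-- `h ↦ X¹ β S(X²) h X³`. -/
noncomputable def phiSandwich : H →ₗ[k] H where
  toFun h := betaMiddleMap h (phi k H)
  map_add' g h := by
    generalize phi k H = w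
    induction w using induction₃ with
    | zero => simp
    | add v w hv hw => simp only [map_add, hv, hw]; abel
    | tmul x y z => simp [mul_add, add_mul]
  map_smul' c h := by
    generalize phi k H = w
    induction w using induction₃ with
    | zero => simp
    | add v w hv hw => simp only [map_add, hv, hw, smul_add]
    | tmul x y z => simp

theorem phiSandwich_alpha : phiSandwich k H (alpha k H) = 1 := betaAlphaMap_phi

/-- Since `S` is an anti-homomorphism, `ker S` is an ideal: everything from `i` up to `y` is a
single element of `ker S`, and it stands immediately left of `b`. -/
theorem mul_phiSandwich_eq_zero {b : H} (hb : ∀ h : H, antipode k h = 0 → h * b = 0)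
    {i : H} (hi : antipode k i = 0) (y g : H) : i * phiSandwich k H (y * b * g) = 0 := by
  change i * betaMiddleMap _ (phi k H) = 0
  generalize phi k H = w
  induction w using induction₃ with
  | zero => simp
  | add v w hv hw => simp only [map_add, mul_add, hv, hw, add_zero]
  | tmul x₁ x₂ x₃ =>
    have := hb (i * x₁ * beta k H * antipode k x₂ * y) (by simp [antipode_mul, hi])
    rw [betaMiddleMap_tmul]
    calc _ = (i * x₁ * beta k H * antipode k x₂ * y * b) * g * x₃ := by simp only [mul_assoc]
      _ = 0 := by rw [this, zero_mul, zero_mul]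

/-- Expanding `Δ(t)` over a basis in the first leg lets `(1 ⊗ h)Δ(t) = 0` be read off coefficient by
coefficient. -/
theorem exists_comul_eq_sum {t : H} (ht : IsLeftIntegral k t) :
    ∃ c : Module.Basis.ofVectorSpaceIndex k H →₀ H,
      comul k t = ∑ m ∈ c.support, (m : H) ⊗ₜ[k] c m ∧
        ∀ m, ∀ h : H, antipode k h = 0 → h * c m = 0 := by
  obtain ⟨c, hc⟩ := TensorProduct.eq_repr_basis_left (Module.Basis.ofVectorSpace k H) (comul k t)
  simp only [Module.Basis.ofVectorSpace_apply_self] at hc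
  refine ⟨c, hc.symm, fun m h hh => ?_⟩
  have h0 := one_tmul_mul_comul_eq_zero ht hh
  have h1 : (c.mapRange (h * ·) (mul_zero h)).sum
      (fun i n => Module.Basis.ofVectorSpace k H i ⊗ₜ[k] n) = 0 := by
    rw [Finsupp.sum_mapRange_index (by simp), ← h0, ← hc, Finsupp.sum, Finsupp.sum, Finset.mul_sum]
    simp
  have := DFunLike.congr_fun (TensorProduct.sum_tmul_basis_left_eq_zero _ _ h1) m
  simpa using this

/-- The two sides of coassociativity at `t` are compared after a contraction that recovers `t ⊗ i`
from `(I ⊗ Δ)Δ(t)` and vanishes on `φ(Δ ⊗ I)Δ(t)φ⁻¹`. -/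
theorem antipode_injective {t : H} (ht : IsLeftIntegral k t) (ht0 : t ≠ 0) :
    Function.Injective (antipode k (H := H)) := by
  rw [injective_iff_map_eq_zero]
  intro i hi
  -- `phiSandwich` undoes `α`, so on `x ⊗ Δ(y)` this map gives `ε(y) x ⊗ i`, with no further factor.
  let G : H ⊗[k] (H ⊗[k] H) →ₗ[k] H ⊗[k] H :=
    TensorProduct.map LinearMap.id (LinearMap.mulLeft k i ∘ₗ phiSandwich k H ∘ₗ alphaMap k H)
  have hG : ∀ (x : H) (d : H ⊗[k] H), G (x ⊗ₜ d) = x ⊗ₜ (i * phiSandwich k H (alphaMap k H d)) :=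
    fun x d => rfl
  have h1 : ∀ d : H ⊗[k] H,
      G (Algebra.TensorProduct.map (AlgHom.id k H) (comul k) d) = R₀ d ⊗ₜ i := by
    intro d
    induction d with
    | zero => simp
    | add v w hv hw => simp only [map_add, TensorProduct.add_tmul, hv, hw]
    | tmul x y =>
      rw [Algebra.TensorProduct.map_tmul, hG, alphaMap_comul, map_smul, phiSandwich_alpha]
      simp [TensorProduct.smul_tmul']
  -- In the form `φ(Δ ⊗ I)Δ(t)φ⁻¹` the second leg `b` of `Δ(t)` is not split, and in the value of
  -- `G` everything between `i` and `b` stays in `ker S`.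
  have h2 : ∀ {b : H} (_ : ∀ h : H, antipode k h = 0 → h * b = 0) (d : H ⊗[k] H)
      (w z : H ⊗[k] (H ⊗[k] H)),
      G (w * Algebra.TensorProduct.assoc k k k H H H (d ⊗ₜ b) * z) = 0 := by
    intro b hb d w z
    induction d with
    | zero => simp
    | add v w hv hw =>
      simp only [TensorProduct.add_tmul, map_add, add_mul, mul_add, hv, hw, add_zero]
    | tmul x y =>
      induction w using induction₃ with
      | zero => simp
      | add v w hv hw => simp only [map_add, add_mul, hv, hw, add_zero]
      | tmul w₁ w₂ w₃ =>
        induction z using induction₃ with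
        | zero => simp
        | add v w hv hw => simp only [map_add, mul_add, hv, hw, add_zero]
        | tmul z₁ z₂ z₃ =>
          simp only [Algebra.TensorProduct.assoc_tmul, Algebra.TensorProduct.tmul_mul_tmul, hG,
            alphaMap_tmul]
          rw [← mul_assoc, ← mul_assoc, mul_phiSandwich_eq_zero hb hi, TensorProduct.tmul_zero]
  obtain ⟨c, hs, hb⟩ := exists_comul_eq_sum ht
  have h3 : t ⊗ₜ[k] i = 0 := by
    have := h1 (comul k t)
    rw [R₀_comul] at this
    rw [← this, ← QuasiBialgebra.coassoc, show QuasiBialgebra.comul t = comul k t from rfl, hs]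
    simp only [map_sum, Finset.mul_sum, Finset.sum_mul]
    exact Finset.sum_eq_zero fun m _ => h2 (hb m) _ _ _
  -- A functional that does not vanish on `t` extracts `i = 0` from `t ⊗ i = 0`.
  obtain ⟨f, hf⟩ := not_forall.mp (mt (Module.forall_dual_apply_eq_zero_iff k t).mp ht0)
  have h4 := congrArg ((TensorProduct.lid k H).toLinearMap ∘ₗ TensorProduct.map f LinearMap.id) h3
  simpa [hf] using h4

theorem antipode_bijective [FiniteDimensional k H] {t : H} (ht : IsLeftIntegral k t)
    (ht0 : t ≠ 0) : Function.Bijective (antipode k (H := H)) :=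
  ⟨antipode_injective ht ht0,
    LinearMap.injective_iff_surjective.mp (antipode_injective ht ht0)⟩

theorem antipode_antipodeInv (hS : Function.Bijective (antipode k (H := H))) (h : H) :
    antipode k (antipodeInv k H h) = h := by
  rw [antipodeInv, dif_pos hS]
  exact (LinearEquiv.ofBijective (antipode k (H := H)) hS).apply_symm_apply h

theorem antipodeInv_antipode (hS : Function.Bijective (antipode k (H := H))) (h : H) :
    antipodeInv k H (antipode k h) = h :=
  hS.1 (antipode_antipodeInv hS _)

theorem antipodeInv_mul (hS : Function.Bijective (antipode k (H := H))) (g h : H) :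
    antipodeInv k H (g * h) = antipodeInv k H h * antipodeInv k H g :=
  hS.1 (by simp only [antipode_mul, antipode_antipodeInv hS])

theorem antipodeInv_one (hS : Function.Bijective (antipode k (H := H))) :
    antipodeInv k H (1 : H) = 1 :=
  hS.1 (by rw [antipode_antipodeInv hS, antipode_one])

end AntipodeBijective

/-! ### The identities linking `p_L` and `q_L` -/

section LeftIdentities

variable {k H : Type*} [Field k] [Ring H] [Algebra k H] [QuasiHopfAlgebra k H]

theorem phi_mul_coassoc (h : H) :
    phi k H * Algebra.TensorProduct.assoc k k k H H H
        (Algebra.TensorProduct.map (comul k) (AlgHom.id k H) (comul k h)) =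
      Algebra.TensorProduct.map (AlgHom.id k H) (comul k) (comul k h) * phi k H := by
  have h1 := QuasiBialgebra.coassoc (k := k) h
  have h2 : ((QuasiBialgebra.associator⁻¹ : (H ⊗[k] (H ⊗[k] H))ˣ) : H ⊗[k] (H ⊗[k] H)) *
    phi k H = 1 := phiInv_mul_phi
  rw [← h1, mul_assoc _ _ (phi k H), h2, mul_one]

/-- The pentagon with `D₁` leftmost and `D₂` rightmost, as the contraction `S(x) α y β S(z)`
requires. -/
theorem D₃_phiInv_mul_one_tmul_phi :
    D₃ (phiInv k H) * ((1 : H) ⊗ₜ[k] phi k H) =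
      D₁ (phi k H) * E₁ (phiInv k H) * D₂ (phiInv k H) := by
  have h1 : D₁ (phi k H) * D₁ (phiInv k H) = 1 := by rw [← map_mul, phi_mul_phiInv, map_one]
  have h2 : E₁ (phiInv k H) * E₁ (phi k H) = 1 := by rw [← map_mul, phiInv_mul_phi, map_one]
  have h4 : ((1 : H) ⊗ₜ[k] phiInv k H) * ((1 : H) ⊗ₜ[k] phi k H) = 1 := by
    rw [Algebra.TensorProduct.tmul_mul_tmul, phiInv_mul_phi, one_mul]; rfl
  have hp := congrArg (fun v => D₁ (phi k H) * (E₁ (phiInv k H) * (v * ((1 : H) ⊗ₜ[k] phi k H))))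
    (SmashProduct.pentagon_inv (k := k) (H := H))
  simp only [mul_assoc _ _ ((1 : H) ⊗ₜ[k] phi k H), h4, mul_one] at hp
  rw [mul_assoc, ← hp]
  simp only [mul_assoc]
  rw [← mul_assoc (E₁ (phiInv k H)), h2, one_mul, ← mul_assoc (D₁ (phi k H)), h1, one_mul]

theorem E₁_phi_mul_D₁_phiInv :
    E₁ (phi k H) * D₁ (phiInv k H) =
      D₂ (phiInv k H) * ((1 : H) ⊗ₜ[k] phiInv k H) * D₃ (phi k H) := by
  have h1 : D₃ (phiInv k H) * D₃ (phi k H) = 1 := by rw [← map_mul, phiInv_mul_phi, map_one]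
  rw [← SmashProduct.pentagon_inv, mul_assoc _ _ (D₃ (phi k H)), h1, mul_one]

variable (k H) in
/-- `x ⊗ y ⊗ z ↦ y S⁻¹(x β) ⊗ z`. -/
noncomputable def pLMap : H ⊗[k] (H ⊗[k] H) →ₗ[k] H ⊗[k] H :=
  TensorProduct.map (antipodeInv k H ∘ₗ betaMap k H) LinearMap.id ∘ₗ
    (TensorProduct.assoc k H H H).symm.toLinearMap

theorem pLMap_tmul (x y z : H) :
    pLMap k H (x ⊗ₜ (y ⊗ₜ z)) = (antipodeInv k H (x * beta k H * antipode k y)) ⊗ₜ z := by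
  simp [pLMap]

/-- Writing `X² S⁻¹(X¹β)` as `S⁻¹(X¹ β S(X²))` puts `p_L` in terms of `betaMap`, so the axiom for
`β` applies to it directly. -/
theorem pLMap_phi (hS : Function.Bijective (antipode k (H := H))) :
    pLMap k H (phi k H) = pL k H := by
  change TensorProduct.map _ _ _ = TensorProduct.map _ _ _
  congr 2
  ext x y
  simp [antipodeInv_mul hS, antipodeInv_antipode hS]

theorem pLMap_mul_comul_tmul
    (w : H ⊗[k] (H ⊗[k] H)) (x y : H) :
    pLMap k H (w * Algebra.TensorProduct.assoc k k k H H H (comul k x ⊗ₜ y)) =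
      counit k x • (pLMap k H w * ((1 : H) ⊗ₜ[k] y)) := by
  induction w using induction₃ with
  | zero => simp
  | add v w hv hw => simp only [add_mul, map_add, smul_add, hv, hw]
  | tmul a b c =>
    have : ∀ d : H ⊗[k] H, pLMap k H ((a ⊗ₜ (b ⊗ₜ c)) *
        Algebra.TensorProduct.assoc k k k H H H (d ⊗ₜ y)) =
        (antipodeInv k H (a * betaMap k H d * antipode k b)) ⊗ₜ (c * y) := by
      intro d
      induction d with
      | zero => simp
      | add v w hv hw => simp only [TensorProduct.add_tmul, map_add, add_mul, mul_add, hv, hw]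
      | tmul x y => simp [pLMap_tmul, antipode_mul, mul_assoc]
    rw [this, betaMap_comul]
    simp [pLMap_tmul, TensorProduct.smul_tmul', mul_assoc]

theorem pLMap_tmul_mul (hS : Function.Bijective (antipode k (H := H)))
    (x : H) (d : H ⊗[k] H) (w : H ⊗[k] (H ⊗[k] H)) :
    pLMap k H ((x ⊗ₜ d) * w) = d * pLMap k H w * (antipodeInv k H x ⊗ₜ 1) := by
  induction w using induction₃ with
  | zero => simp
  | add v w hv hw => simp only [add_mul, mul_add, map_add, hv, hw]
  | tmul a b c =>
    induction d with
    | zero => simp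
    | add v w hv hw => simp only [add_mul, TensorProduct.tmul_add, map_add, hv, hw]
    | tmul y z =>
      simp [pLMap_tmul, antipode_mul, antipodeInv_mul hS, antipodeInv_antipode hS, mul_assoc]

variable (k H) in
/-- `d ↦ Δ(d₂) p_L (S⁻¹(d₁) ⊗ 1)`. -/
noncomputable def pLTwist : H ⊗[k] H →ₗ[k] H ⊗[k] H :=
  TensorProduct.lift (LinearMap.mk₂ k
    (fun x y => comul k y * pL k H * (antipodeInv k H x ⊗ₜ 1))
    (fun x x' y => by simp only [map_add, TensorProduct.add_tmul, mul_add])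
    (fun c x y => by
      simp only [map_smul, ← TensorProduct.smul_tmul', mul_smul_comm])
    (fun x y y' => by simp only [map_add, add_mul])
    (fun c x y => by simp only [map_smul, smul_mul_assoc]))

@[simp] theorem pLTwist_tmul (x y : H) :
    pLTwist k H (x ⊗ₜ y) = comul k y * pL k H * (antipodeInv k H x ⊗ₜ 1) := rfl

/-- `Δ(h₂) p_L (S⁻¹(h₁) ⊗ 1) = p_L (1 ⊗ h)`. -/
theorem pLTwist_comul (hS : Function.Bijective (antipode k (H := H))) (h : H) :
    pLTwist k H (comul k h) = pL k H * ((1 : H) ⊗ₜ[k] h) := by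
  have h1 : ∀ d : H ⊗[k] H, pLTwist k H d = pLMap k H
      (Algebra.TensorProduct.map (AlgHom.id k H) (comul k) d * phi k H) := by
    intro d
    induction d with
    | zero => simp
    | add v w hv hw => simp only [map_add, add_mul, hv, hw]
    | tmul x y =>
      rw [Algebra.TensorProduct.map_tmul, pLMap_tmul_mul hS, pLMap_phi hS]; rfl
  have h2 : ∀ d : H ⊗[k] H, pLMap k H (phi k H * Algebra.TensorProduct.assoc k k k H H H
      (Algebra.TensorProduct.map (comul k) (AlgHom.id k H) d)) =
      pL k H * ((1 : H) ⊗ₜ[k] L₀ d) := by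
    intro d
    induction d with
    | zero => simp
    | add v w hv hw => simp only [map_add, mul_add, TensorProduct.tmul_add, hv, hw]
    | tmul x y =>
      rw [Algebra.TensorProduct.map_tmul, pLMap_mul_comul_tmul, pLMap_phi hS]; simp
  rw [h1, ← phi_mul_coassoc, h2, L₀_comul]

theorem pLTwist_mul_comul (hS : Function.Bijective (antipode k (H := H)))
    (d : H ⊗[k] H) (h : H) :
    pLTwist k H (d * comul k h) = pLTwist k H d * ((1 : H) ⊗ₜ[k] h) := by
  induction d with
  | zero => simp
  | add v w hv hw => simp only [map_add, add_mul, hv, hw]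
  | tmul x y =>
    have : ∀ e : H ⊗[k] H, pLTwist k H ((x ⊗ₜ y) * e) =
        comul k y * pLTwist k H e * (antipodeInv k H x ⊗ₜ 1) := by
      intro e
      induction e with
      | zero => simp
      | add v w hv hw => simp only [map_add, mul_add, add_mul, hv, hw]
      | tmul a b => simp [antipodeInv_mul hS, mul_assoc]
    rw [this, pLTwist_comul hS, pLTwist_tmul]
    simp only [mul_assoc, Algebra.TensorProduct.tmul_mul_tmul, mul_one, one_mul]

variable (k H) in
/-- `x ⊗ y ⊗ z ⊗ u ↦ S⁻¹(S(x) α y β S(z)) ⊗ u`. -/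
noncomputable def alphaBetaMap₄ : H ⊗[k] (H ⊗[k] (H ⊗[k] H)) →ₗ[k] H ⊗[k] H :=
  TensorProduct.map (antipodeInv k H ∘ₗ alphaBetaMap k H) LinearMap.id ∘ₗ rebracket k H

@[simp] theorem alphaBetaMap₄_tmul (x y z u : H) :
    alphaBetaMap₄ k H (x ⊗ₜ (y ⊗ₜ (z ⊗ₜ u))) =
      antipodeInv k H (antipode k x * alpha k H * y * beta k H * antipode k z) ⊗ₜ u := by
  simp [alphaBetaMap₄]

theorem alphaBetaMap₄_D₁_mul (hS : Function.Bijective (antipode k (H := H)))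
    (w : H ⊗[k] (H ⊗[k] H)) (v : H ⊗[k] (H ⊗[k] (H ⊗[k] H))) :
    alphaBetaMap₄ k H (D₁ w * v) = L₁ w * alphaBetaMap₄ k H v := by
  induction v using induction₄ with
  | zero => simp
  | add v w hv hw => simp only [mul_add, map_add, hv, hw]
  | tmul a b c e =>
    induction w using induction₃ with
    | zero => simp
    | add v w hv hw => simp only [map_add, add_mul, hv, hw]
    | tmul x y z =>
      have : ∀ d : H ⊗[k] H, alphaBetaMap₄ k H (
          Algebra.TensorProduct.assoc k k k H H (H ⊗[k] H) (d ⊗ₜ[k] (y ⊗ₜ[k] z)) *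
            (a ⊗ₜ (b ⊗ₜ (c ⊗ₜ e)))) =
          (antipodeInv k H (antipode k a * alphaMap k H d * b * beta k H * antipode k (y * c))) ⊗ₜ
            (z * e) := by
        intro d
        induction d with
        | zero => simp
        | add v w hv hw => simp only [TensorProduct.add_tmul, map_add, add_mul, mul_add, hv, hw]
        | tmul x y => simp [antipode_mul, mul_assoc]
      refine (this (comul k x)).trans ?_
      rw [alphaMap_comul]
      simp [TensorProduct.smul_tmul', mul_assoc, antipode_mul, antipodeInv_mul hS,
        antipodeInv_antipode hS]

theorem alphaBetaMap₄_mul_D₂ (hS : Function.Bijective (antipode k (H := H)))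
    (v : H ⊗[k] (H ⊗[k] (H ⊗[k] H))) (w : H ⊗[k] (H ⊗[k] H)) :
    alphaBetaMap₄ k H (v * D₂ w) = alphaBetaMap₄ k H v * L₂ w := by
  induction v using induction₄ with
  | zero => simp
  | add v w hv hw => simp only [add_mul, map_add, hv, hw]
  | tmul a b c e =>
    induction w using induction₃ with
    | zero => simp
    | add v w hv hw => simp only [map_add, mul_add, hv, hw]
    | tmul x y z =>
      have : ∀ d : H ⊗[k] H, alphaBetaMap₄ k H ((a ⊗ₜ (b ⊗ₜ (c ⊗ₜ e))) * (x ⊗ₜ[k]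
          Algebra.TensorProduct.assoc k k k H H H (d ⊗ₜ[k] z))) =
          (antipodeInv k H (antipode k (a * x) * alpha k H * b * betaMap k H d * antipode k c)) ⊗ₜ
            (e * z) := by
        intro d
        induction d with
        | zero => simp
        | add v w hv hw =>
          simp only [TensorProduct.add_tmul, TensorProduct.tmul_add, map_add, add_mul, mul_add,
            hv, hw]
        | tmul x y => simp [antipode_mul, mul_assoc]
      refine (this (comul k y)).trans ?_
      rw [betaMap_comul]
      simp [TensorProduct.smul_tmul', mul_assoc, antipode_mul, antipodeInv_mul hS,
        antipodeInv_antipode hS]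

theorem alphaBetaMap₄_E₁ (w : H ⊗[k] (H ⊗[k] H)) :
    alphaBetaMap₄ k H (E₁ w) = antipodeInv k H (alphaBetaMap k H w) ⊗ₜ 1 := by
  induction w using induction₃ with
  | zero => simp
  | add v w hv hw => simp only [map_add, TensorProduct.add_tmul, hv, hw]
  | tmul x y z => simp

theorem alphaBetaMap₄_D₃_phiInv_mul (hS : Function.Bijective (antipode k (H := H))) :
    alphaBetaMap₄ k H (D₃ (phiInv k H) * ((1 : H) ⊗ₜ[k] phi k H)) = 1 := by
  rw [D₃_phiInv_mul_one_tmul_phi, alphaBetaMap₄_mul_D₂ hS, alphaBetaMap₄_D₁_mul hS,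
    alphaBetaMap₄_E₁, alphaBetaMap_phiInv, antipodeInv_one hS, L₁_phi, L₂_phiInv, one_mul, mul_one]
  rfl

/-- Gathering all factors of the first leg under one `S⁻¹` gives `S⁻¹(S(x) α y β S(z))`, so the left
side is a contraction of `D₃(φ⁻¹)(1 ⊗ φ)`, which the pentagon evaluates to `1`. -/
theorem pLTwist_qL (hS : Function.Bijective (antipode k (H := H))) :
    pLTwist k H (qL k H) = 1 := by
  have key : ∀ w : H ⊗[k] (H ⊗[k] H), pLTwist k H (qLMap k H w) =
      alphaBetaMap₄ k H (D₃ w * ((1 : H) ⊗ₜ[k] phi k H)) := by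
    intro w
    induction w using induction₃ with
    | zero => simp
    | add v w hv hw => simp only [map_add, add_mul, hv, hw]
    | tmul x y z =>
      change _ = alphaBetaMap₄ k H ((x ⊗ₜ (y ⊗ₜ comul k z)) * _)
      rw [qLMap_tmul, pLTwist_tmul, ← pLMap_phi hS]
      generalize comul k z = d
      generalize phi k H = w
      induction w using induction₃ with
      | zero => simp
      | add v w hv hw => simp only [map_add, add_mul, mul_add, TensorProduct.tmul_add, hv, hw]
      | tmul a b c =>
        induction d with
        | zero => simp
        | add v w hv hw => simp only [map_add, add_mul, TensorProduct.tmul_add, hv, hw]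
        | tmul d₁ d₂ =>
          simp [pLMap_tmul, antipode_mul, antipodeInv_mul hS, antipodeInv_antipode hS, mul_assoc]
  rw [← qLMap_phiInv, key, alphaBetaMap₄_D₃_phiInv_mul hS]

/-- Applying `S` to the first leg of `p_L` removes the `S⁻¹`, leaving the contracted pentagon that
was used for `Δ(t)`. -/
theorem qLTwist_pL (hS : Function.Bijective (antipode k (H := H))) :
    qLTwist k H (pL k H) = 1 := by
  have key : ∀ w : H ⊗[k] (H ⊗[k] H), qLTwist k H (pLMap k H w) =
      betaAlphaMap₄ k H (((1 : H) ⊗ₜ[k] phiInv k H) * D₃ w) := by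
    intro w
    induction w using induction₃ with
    | zero => simp
    | add v w hv hw => simp only [map_add, mul_add, hv, hw]
    | tmul x y z =>
      change _ = betaAlphaMap₄ k H (_ * (x ⊗ₜ (y ⊗ₜ comul k z)))
      rw [betaAlphaMap₄_one_tmul_mul, pLMap_tmul, qLTwist_tmul, antipode_antipodeInv hS,
        qLMap_phiInv, betaMap_tmul, mul_assoc]
  rw [← pLMap_phi hS, key, betaAlphaMap₄_phiInv_mul_D₃_phi]

theorem qLTwist_comul_mul_pL (hS : Function.Bijective (antipode k (H := H))) (h : H) :
    qLTwist k H (comul k h * pL k H) = (1 : H) ⊗ₜ[k] h := by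
  rw [qLTwist_comul_mul, qLTwist_pL hS, mul_one]

theorem pLTwist_qL_mul_comul (hS : Function.Bijective (antipode k (H := H))) (h : H) :
    pLTwist k H (qL k H * comul k h) = (1 : H) ⊗ₜ[k] h := by
  rw [pLTwist_mul_comul hS, pLTwist_qL hS, one_mul]

end LeftIdentities

/-! ### The right-handed elements `p_R`, `q_R` -/

section RightIdentities

variable {k H : Type*} [Field k] [Ring H] [Algebra k H]

/-- `x ⊗ y ↦ y T(x)`. -/
noncomputable def evalMulMap (T : H →ₗ[k] H) : H ⊗[k] H →ₗ[k] H :=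
  LinearMap.mul' k H ∘ₗ (TensorProduct.comm k H H).toLinearMap ∘ₗ TensorProduct.map T LinearMap.id

@[simp] theorem evalMulMap_tmul (T : H →ₗ[k] H) (x y : H) :
    evalMulMap T (x ⊗ₜ y) = y * T x := rfl

variable [QuasiHopfAlgebra k H]

variable (k H) in
/-- `x ⊗ y ⊗ z ↦ x ⊗ S⁻¹(α z) y`. -/
noncomputable def qRMap : H ⊗[k] (H ⊗[k] H) →ₗ[k] H ⊗[k] H :=
  TensorProduct.map LinearMap.id (antipodeInv k H ∘ₗ alphaMap k H)

@[simp] theorem qRMap_tmul (x y z : H) :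
    qRMap k H (x ⊗ₜ (y ⊗ₜ z)) = x ⊗ₜ antipodeInv k H (antipode k y * alpha k H * z) := by
  simp [qRMap]

variable (k H) in
/-- `q_R = X¹ ⊗ S⁻¹(α X³) X²`. -/
noncomputable def qR : H ⊗[k] H := qRMap k H (phi k H)

variable (k H) in
/-- `x ⊗ y ⊗ z ↦ x ⊗ y β S(z)`. -/
noncomputable def pRMap : H ⊗[k] (H ⊗[k] H) →ₗ[k] H ⊗[k] H :=
  TensorProduct.map LinearMap.id (betaMap k H)

@[simp] theorem pRMap_tmul (x y z : H) :
    pRMap k H (x ⊗ₜ (y ⊗ₜ z)) = x ⊗ₜ (y * beta k H * antipode k z) := by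
  simp [pRMap]

variable (k H) in
/-- `p_R = x¹ ⊗ x² β S(x³)`. -/
noncomputable def pR : H ⊗[k] H := pRMap k H (phiInv k H)

theorem qRMap_tmul_comul_mul (x y : H) (w : H ⊗[k] (H ⊗[k] H)) :
    qRMap k H ((x ⊗ₜ comul k y) * w) = counit k y • ((x ⊗ₜ[k] (1 : H)) * qRMap k H w) := by
  induction w using induction₃ with
  | zero => simp
  | add v w hv hw => simp only [mul_add, map_add, smul_add, hv, hw]
  | tmul a b c =>
    have : ∀ d : H ⊗[k] H, qRMap k H ((x ⊗ₜ d) * (a ⊗ₜ (b ⊗ₜ c))) =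
        (x * a) ⊗ₜ antipodeInv k H (antipode k b * alphaMap k H d * c) := by
      intro d
      induction d with
      | zero => simp
      | add v w hv hw => simp only [TensorProduct.tmul_add, map_add, add_mul, mul_add, hv, hw]
      | tmul x y => simp [antipode_mul, mul_assoc]
    rw [this, alphaMap_comul]
    simp

theorem qRMap_mul_assoc_tmul (hS : Function.Bijective (antipode k (H := H)))
    (w : H ⊗[k] (H ⊗[k] H)) (d : H ⊗[k] H) (y : H) :
    qRMap k H (w * Algebra.TensorProduct.assoc k k k H H H (d ⊗ₜ y)) =
      ((1 : H) ⊗ₜ antipodeInv k H y) * qRMap k H w * d := by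
  induction w using induction₃ with
  | zero => simp
  | add v w hv hw => simp only [mul_add, add_mul, map_add, hv, hw]
  | tmul a b c =>
    induction d with
    | zero => simp
    | add v w hv hw => simp only [mul_add, TensorProduct.add_tmul, map_add, hv, hw]
    | tmul e f =>
      simp [antipode_mul, antipodeInv_mul hS, antipodeInv_antipode hS, mul_assoc]

variable (k H) in
/-- `d ↦ (1 ⊗ S⁻¹(d₂)) q_R Δ(d₁)`. -/
noncomputable def qRTwist : H ⊗[k] H →ₗ[k] H ⊗[k] H :=
  TensorProduct.lift (LinearMap.mk₂ k
    (fun x y => ((1 : H) ⊗ₜ antipodeInv k H y) * qR k H * comul k x)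
    (fun x x' y => by simp only [map_add, mul_add])
    (fun c x y => by simp only [map_smul, mul_smul_comm])
    (fun x y y' => by simp only [map_add, TensorProduct.tmul_add, add_mul])
    (fun c x y => by simp only [map_smul, TensorProduct.tmul_smul, smul_mul_assoc]))

@[simp] theorem qRTwist_tmul (x y : H) :
    qRTwist k H (x ⊗ₜ y) = ((1 : H) ⊗ₜ antipodeInv k H y) * qR k H * comul k x := rfl

/-- `(1 ⊗ S⁻¹(h₂)) q_R Δ(h₁) = (h ⊗ 1) q_R`. -/
theorem qRTwist_comul (hS : Function.Bijective (antipode k (H := H))) (h : H) :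
    qRTwist k H (comul k h) = (h ⊗ₜ[k] (1 : H)) * qR k H := by
  have h1 : ∀ d : H ⊗[k] H, qRTwist k H d = qRMap k H (phi k H *
      Algebra.TensorProduct.assoc k k k H H H
        (Algebra.TensorProduct.map (comul k) (AlgHom.id k H) d)) := by
    intro d
    induction d with
    | zero => simp
    | add v w hv hw => simp only [map_add, mul_add, hv, hw]
    | tmul x y =>
      rw [Algebra.TensorProduct.map_tmul, qRMap_mul_assoc_tmul hS]; rfl
  have h2 : ∀ d : H ⊗[k] H, qRMap k H
      (Algebra.TensorProduct.map (AlgHom.id k H) (comul k) d * phi k H) =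
      (R₀ d ⊗ₜ[k] (1 : H)) * qR k H := by
    intro d
    induction d with
    | zero => simp
    | add v w hv hw => simp only [map_add, add_mul, TensorProduct.add_tmul, hv, hw]
    | tmul x y =>
      rw [Algebra.TensorProduct.map_tmul, qRMap_tmul_comul_mul]
      simp [← TensorProduct.smul_tmul', qR]
  rw [h1, phi_mul_coassoc, h2, R₀_comul]

theorem qRTwist_comul_mul (hS : Function.Bijective (antipode k (H := H))) (h : H)
    (d : H ⊗[k] H) : qRTwist k H (comul k h * d) = (h ⊗ₜ[k] (1 : H)) * qRTwist k H d := by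
  induction d with
  | zero => simp
  | add v w hv hw => simp only [map_add, mul_add, hv, hw]
  | tmul x y =>
    have : ∀ e : H ⊗[k] H, qRTwist k H (e * (x ⊗ₜ y)) =
        ((1 : H) ⊗ₜ antipodeInv k H y) * qRTwist k H e * comul k x := by
      intro e
      induction e with
      | zero => simp
      | add v w hv hw => simp only [map_add, mul_add, add_mul, hv, hw]
      | tmul a b =>
        simp only [Algebra.TensorProduct.tmul_mul_tmul, qRTwist_tmul, antipodeInv_mul hS, map_mul,
          mul_assoc]
        rw [← mul_assoc ((1 : H) ⊗ₜ[k] antipodeInv k H y), Algebra.TensorProduct.tmul_mul_tmul,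
          mul_one]
    rw [this, qRTwist_comul hS, qRTwist_tmul]
    simp only [← mul_assoc, Algebra.TensorProduct.tmul_mul_tmul, mul_one, one_mul]

variable (k H) in
/-- `x ⊗ y ⊗ z ⊗ u ↦ x ⊗ S⁻¹(S(y) α z β S(u))`. -/
noncomputable def alphaBetaMapRight : H ⊗[k] (H ⊗[k] (H ⊗[k] H)) →ₗ[k] H ⊗[k] H :=
  TensorProduct.map LinearMap.id (antipodeInv k H ∘ₗ alphaBetaMap k H)

@[simp] theorem alphaBetaMapRight_tmul (x : H) (w : H ⊗[k] (H ⊗[k] H)) :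
    alphaBetaMapRight k H (x ⊗ₜ w) = x ⊗ₜ antipodeInv k H (alphaBetaMap k H w) := rfl

theorem alphaBetaMapRight_mul_D₃ (hS : Function.Bijective (antipode k (H := H)))
    (v : H ⊗[k] (H ⊗[k] (H ⊗[k] H))) (w : H ⊗[k] (H ⊗[k] H)) :
    alphaBetaMapRight k H (v * D₃ w) = alphaBetaMapRight k H v * L₃ w := by
  induction v using induction₄ with
  | zero => simp
  | add v w hv hw => simp only [add_mul, map_add, hv, hw]
  | tmul a b c e =>
    induction w using induction₃ with
    | zero => simp
    | add v w hv hw => simp only [map_add, mul_add, hv, hw]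
    | tmul x y z =>
      have : ∀ d : H ⊗[k] H, alphaBetaMapRight k H ((a ⊗ₜ (b ⊗ₜ (c ⊗ₜ e))) *
          (x ⊗ₜ[k] (y ⊗ₜ[k] d))) = (a * x) ⊗ₜ antipodeInv k H
            (antipode k (b * y) * alpha k H * c * betaMap k H d * antipode k e) := by
        intro d
        induction d with
        | zero => simp
        | add v w hv hw =>
          simp only [TensorProduct.tmul_add, map_add, add_mul, mul_add, hv, hw]
        | tmul x y => simp [antipode_mul, mul_assoc]
      refine (this (comul k z)).trans ?_
      rw [betaMap_comul]
      simp [mul_assoc, antipode_mul, antipodeInv_mul hS, antipodeInv_antipode hS]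

theorem alphaBetaMapRight_D₂_mul (hS : Function.Bijective (antipode k (H := H)))
    (w : H ⊗[k] (H ⊗[k] H)) (v : H ⊗[k] (H ⊗[k] (H ⊗[k] H))) :
    alphaBetaMapRight k H (D₂ w * v) = L₂ w * alphaBetaMapRight k H v := by
  induction v using induction₄ with
  | zero => simp
  | add v w hv hw => simp only [mul_add, map_add, hv, hw]
  | tmul a b c e =>
    induction w using induction₃ with
    | zero => simp
    | add v w hv hw => simp only [map_add, add_mul, hv, hw]
    | tmul x y z =>
      have : ∀ d : H ⊗[k] H, alphaBetaMapRight k H ((x ⊗ₜ[k]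
          Algebra.TensorProduct.assoc k k k H H H (d ⊗ₜ[k] z)) * (a ⊗ₜ (b ⊗ₜ (c ⊗ₜ e)))) =
          (x * a) ⊗ₜ antipodeInv k H
            (antipode k b * alphaMap k H d * c * beta k H * antipode k (z * e)) := by
        intro d
        induction d with
        | zero => simp
        | add v w hv hw =>
          simp only [TensorProduct.add_tmul, TensorProduct.tmul_add, map_add, add_mul, mul_add,
            hv, hw]
        | tmul x y => simp [antipode_mul, mul_assoc]
      refine (this (comul k y)).trans ?_
      rw [alphaMap_comul]
      simp [mul_assoc, antipode_mul, antipodeInv_mul hS, antipodeInv_antipode hS]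

/-- The counterpart of `pLTwist_qL`, with the contraction acting on the last three legs and the
pentagon in the form `E₁_phi_mul_D₁_phiInv`. -/
theorem qRTwist_pR (hS : Function.Bijective (antipode k (H := H))) :
    qRTwist k H (pR k H) = 1 := by
  have key : ∀ w : H ⊗[k] (H ⊗[k] H), qRTwist k H (pRMap k H w) =
      alphaBetaMapRight k H (E₁ (phi k H) * D₁ w) := by
    intro w
    induction w using induction₃ with
    | zero => simp
    | add v w hv hw => simp only [map_add, mul_add, hv, hw]
    | tmul x y z =>
      change _ = alphaBetaMapRight k H (_ *
        Algebra.TensorProduct.assoc k k k H H (H ⊗[k] H) (comul k x ⊗ₜ[k] (y ⊗ₜ[k] z)))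
      rw [pRMap_tmul, qRTwist_tmul, qR]
      generalize comul k x = d
      generalize phi k H = w
      induction w using induction₃ with
      | zero => simp
      | add v w hv hw => simp only [map_add, add_mul, mul_add, hv, hw]
      | tmul a b c =>
        induction d with
        | zero => simp
        | add v w hv hw => simp only [map_add, mul_add, TensorProduct.add_tmul, hv, hw]
        | tmul d₁ d₂ =>
          simp [antipode_mul, antipodeInv_mul hS, antipodeInv_antipode hS, mul_assoc]
  rw [pR, key, E₁_phi_mul_D₁_phiInv, alphaBetaMapRight_mul_D₃ hS, alphaBetaMapRight_D₂_mul hS,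
    L₂_phiInv, L₃_phi, one_mul, mul_one, alphaBetaMapRight_tmul, alphaBetaMap_phiInv,
    antipodeInv_one hS]
  rfl

/-- The elements `(1 ⊗ S⁻¹(y)) q_R Δ(x)` span enough to reach every `h ⊗ 1`, whose evaluation is
`T(h)`; left factors in the second leg come out of `evalMulMap`. -/
theorem eq_zero_of_evalMulMap_qR_mul_comul (hS : Function.Bijective (antipode k (H := H)))
    {T : H →ₗ[k] H} (hT : ∀ x : H, evalMulMap T (qR k H * comul k x) = 0) : T = 0 := by
  have h1 : ∀ d : H ⊗[k] H, evalMulMap T (qRTwist k H d) = 0 := by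
    intro d
    induction d with
    | zero => simp
    | add v w hv hw => simp only [map_add, hv, hw, add_zero]
    | tmul x y =>
      have : ∀ e : H ⊗[k] H, evalMulMap T (((1 : H) ⊗ₜ antipodeInv k H y) * e) =
          antipodeInv k H y * evalMulMap T e := by
        intro e
        induction e with
        | zero => simp
        | add v w hv hw => simp only [map_add, mul_add, hv, hw]
        | tmul a b => simp [mul_assoc]
      rw [qRTwist_tmul, mul_assoc, this, hT, mul_zero]
  ext h
  -- This choice makes the twist equal to `h ⊗ 1`.
  have := h1 (comul k h * pR k H)
  rwa [qRTwist_comul_mul hS, qRTwist_pR hS, mul_one, evalMulMap_tmul, one_mul] at this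

end RightIdentities

/-! ### The bijection `H ⊗ V → V ⊗ H` -/

section DiagonalAction

variable {k H V : Type*} [Field k] [Ring H] [Algebra k H]
  [AddCommGroup V] [Module k V] (ρ : H →ₐ[k] Module.End k V)

/-- `x ⊗ y ↦ ρ(x) v ⊗ y`. -/
noncomputable def tensorOrbit (v : V) : H ⊗[k] H →ₗ[k] V ⊗[k] H :=
  TensorProduct.map (ρ.toLinearMap.flip v) LinearMap.id

@[simp] theorem tensorOrbit_tmul (v : V) (x y : H) :
    tensorOrbit ρ v (x ⊗ₜ y) = ρ x v ⊗ₜ y := rfl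

variable [QuasiHopfAlgebra k H]

/-- `h ⊗ v ↦ h₁ p_L¹ · v ⊗ h₂ p_L²`. -/
noncomputable def diagonalMap : H ⊗[k] V →ₗ[k] V ⊗[k] H :=
  TensorProduct.lift (LinearMap.mk₂ k (fun h v => tensorOrbit ρ v (comul k h * pL k H))
    (fun h h' v => by simp only [map_add, add_mul])
    (fun c h v => by simp only [map_smul, smul_mul_assoc])
    (fun h v v' => by simp only [tensorOrbit, map_add, TensorProduct.map_add_left,
      LinearMap.add_apply])
    (fun c h v => by simp only [tensorOrbit, map_smul, TensorProduct.map_smul_left,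
      LinearMap.smul_apply]))

@[simp] theorem diagonalMap_tmul (h : H) (v : V) :
    diagonalMap ρ (h ⊗ₜ v) = tensorOrbit ρ v (comul k h * pL k H) := rfl

/-- `x ⊗ y ↦ y ⊗ ρ(S⁻¹(x)) v`. -/
noncomputable def invTensorOrbit (v : V) : H ⊗[k] H →ₗ[k] H ⊗[k] V :=
  (TensorProduct.comm k V H).toLinearMap ∘ₗ
    TensorProduct.map (ρ.toLinearMap.flip v ∘ₗ antipodeInv k H) LinearMap.id

@[simp] theorem invTensorOrbit_tmul (v : V) (x y : H) :
    invTensorOrbit ρ v (x ⊗ₜ y) = y ⊗ₜ ρ (antipodeInv k H x) v := rfl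

/-- `v ⊗ h ↦ q_L² h₂ ⊗ S⁻¹(q_L¹ h₁) · v`. -/
noncomputable def diagonalInv : V ⊗[k] H →ₗ[k] H ⊗[k] V :=
  TensorProduct.lift (LinearMap.mk₂ k (fun v h => invTensorOrbit ρ v (qL k H * comul k h))
    (fun v v' h => by simp only [invTensorOrbit, map_add, LinearMap.add_comp,
      TensorProduct.map_add_left, LinearMap.comp_add, LinearMap.add_apply])
    (fun c v h => by simp only [invTensorOrbit, map_smul, LinearMap.smul_comp,
      TensorProduct.map_smul_left, LinearMap.comp_smul, LinearMap.smul_apply])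
    (fun v h h' => by simp only [map_add, mul_add])
    (fun c v h => by simp only [map_smul, mul_smul_comm]))

@[simp] theorem diagonalInv_tmul (v : V) (h : H) :
    diagonalInv ρ (v ⊗ₜ h) = invTensorOrbit ρ v (qL k H * comul k h) := rfl

/-- The composite acts on `h ⊗ v` through `qLTwist (Δ(h) p_L)`, which is `1 ⊗ h`. -/
theorem diagonalInv_diagonalMap (hS : Function.Bijective (antipode k (H := H))) (z : H ⊗[k] V) :
    diagonalInv ρ (diagonalMap ρ z) = z := by
  have key : ∀ (v : V) (d : H ⊗[k] H),
      diagonalInv ρ (tensorOrbit ρ v d) = invTensorOrbit ρ v (qLTwist k H d) := by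
    intro v d
    induction d with
    | zero => simp
    | add d d' hd hd' => simp only [map_add, hd, hd']
    | tmul x y =>
      rw [tensorOrbit_tmul, diagonalInv_tmul, qLTwist_tmul, mul_assoc]
      generalize qL k H * comul k y = e
      induction e with
      | zero => simp
      | add d d' hd hd' => simp only [map_add, mul_add, hd, hd']
      | tmul a b => simp [antipodeInv_mul hS, antipodeInv_antipode hS]
  induction z with
  | zero => simp
  | add z z' hz hz' => simp only [map_add, hz, hz']
  | tmul h v =>
    rw [diagonalMap_tmul, key, qLTwist_comul_mul_pL hS, invTensorOrbit_tmul, antipodeInv_one hS,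
      map_one, Module.End.one_apply]

/-- Here the composite acts through `pLTwist (q_L Δ(h))`, again `1 ⊗ h`. -/
theorem diagonalMap_diagonalInv (hS : Function.Bijective (antipode k (H := H))) (z : V ⊗[k] H) :
    diagonalMap ρ (diagonalInv ρ z) = z := by
  have key : ∀ (v : V) (d : H ⊗[k] H),
      diagonalMap ρ (invTensorOrbit ρ v d) = tensorOrbit ρ v (pLTwist k H d) := by
    intro v d
    induction d with
    | zero => simp
    | add d d' hd hd' => simp only [map_add, hd, hd']
    | tmul x y =>
      rw [invTensorOrbit_tmul, diagonalMap_tmul, pLTwist_tmul]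
      generalize comul k y * pL k H = e
      induction e with
      | zero => simp
      | add d d' hd hd' => simp only [map_add, add_mul, hd, hd']
      | tmul a b => simp
  induction z with
  | zero => simp
  | add z z' hz hz' => simp only [map_add, hz, hz']
  | tmul v h =>
    rw [diagonalInv_tmul, key, pLTwist_qL_mul_comul hS, tensorOrbit_tmul, map_one,
      Module.End.one_apply]

end DiagonalAction

/-! ### One-dimensionality of the integrals and the modular element -/

section Integrals

variable (k H : Type*) [Field k] [Ring H] [Algebra k H]

/-- The action `(h · f)(x) = f(x h)` of `H` on its dual. -/
noncomputable def dualTranslation : H →ₐ[k] Module.End k (Module.Dual k H) :=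
  AlgHom.ofLinearMap
    (LinearMap.mk₂ k (fun h f => f ∘ₗ LinearMap.mulRight k h)
      (fun h h' f => by ext x; simp [mul_add])
      (fun c h f => by ext x; simp)
      (fun h f f' => by ext x; simp)
      (fun c h f => by ext x; simp))
    (by ext f x; simp)
    (fun g h => by ext f x; simp [mul_assoc])

@[simp] theorem dualTranslation_apply (h x : H) (f : Module.Dual k H) :
    dualTranslation k H h f x = f (x * h) := rfl

/-- The space of left integrals. -/
def leftIntegrals [QuasiBialgebra k H] : Submodule k H where
  carrier := {t | IsLeftIntegral k t}
  add_mem' hs ht h := by rw [mul_add, hs h, ht h, smul_add]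
  zero_mem' h := by rw [mul_zero, smul_zero]
  smul_mem' c s hs h := by rw [mul_smul_comm, hs h, smul_comm]

variable {k H}

theorem evalMulMap_add (T T' : H →ₗ[k] H) : evalMulMap (T + T') = evalMulMap T + evalMulMap T' := by
  simp only [evalMulMap, TensorProduct.map_add_left, LinearMap.comp_add]

theorem evalMulMap_smul (c : k) (T : H →ₗ[k] H) : evalMulMap (c • T) = c • evalMulMap T := by
  simp only [evalMulMap, TensorProduct.map_smul_left, LinearMap.comp_smul]

theorem evalMulMap_dualTensorHom_tensorOrbit (f : Module.Dual k H) (d e : H ⊗[k] H) :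
    evalMulMap (dualTensorHom k H H (tensorOrbit (dualTranslation k H) f d)) e =
      TensorProduct.lid k H (TensorProduct.map f LinearMap.id (e * d)) := by
  induction d with
  | zero => simp [evalMulMap]
  | add d d' hd hd' =>
    simp only [map_add, mul_add, ← hd, ← hd', evalMulMap, TensorProduct.map_add_left,
      LinearMap.comp_add, LinearMap.add_apply]
  | tmul x y =>
    induction e with
    | zero => simp
    | add d d' hd hd' => simp only [map_add, add_mul, hd, hd']
    | tmul a b => simp

variable [QuasiHopfAlgebra k H]

variable (k H) in
/-- `s ⊗ f ↦ (x ↦ f(x s₁ p_L¹) s₂ p_L²)` for left integrals `s`. -/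
noncomputable def integralHom : leftIntegrals k H ⊗[k] Module.Dual k H →ₗ[k] H →ₗ[k] H :=
  dualTensorHom k H H ∘ₗ diagonalMap (dualTranslation k H) ∘ₗ
    TensorProduct.map (leftIntegrals k H).subtype LinearMap.id

theorem integralHom_injective [FiniteDimensional k H]
    (hS : Function.Bijective (antipode k (H := H))) : Function.Injective (integralHom k H) := by
  have h1 : Function.Injective (TensorProduct.map (leftIntegrals k H).subtype
      (LinearMap.id : Module.Dual k H →ₗ[k] Module.Dual k H)) :=
    Module.Flat.rTensor_preserves_injective_linearMap _ (leftIntegrals k H).injective_subtype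
  have h2 : Function.Injective (diagonalMap (dualTranslation k H)) :=
    Function.LeftInverse.injective (diagonalInv_diagonalMap (dualTranslation k H) hS)
  exact dualTensorHom_bijective.1.comp (h2.comp h1)

/-- The evaluation applies `f ⊗ I` to `q_R Δ(x) Δ(s) p_L`, and `xs = ε(x)s`. -/
theorem evalMulMap_integralHom (z : leftIntegrals k H ⊗[k] Module.Dual k H) (x : H) :
    evalMulMap (integralHom k H z) (qR k H * comul k x) =
      counit k x • evalMulMap (integralHom k H z) (qR k H) := by
  induction z with
  | zero => simp [evalMulMap]
  | add z z' hz hz' => simp only [map_add, evalMulMap_add, LinearMap.add_apply, smul_add, hz, hz']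
  | tmul s f =>
    have : integralHom k H (s ⊗ₜ f) = dualTensorHom k H H
        (tensorOrbit (dualTranslation k H) f (comul k s.1 * pL k H)) := rfl
    rw [this, evalMulMap_dualTensorHom_tensorOrbit, evalMulMap_dualTensorHom_tensorOrbit,
      ← map_smul, ← map_smul, mul_assoc, ← mul_assoc (comul k x), ← map_mul, s.2 x, map_smul,
      smul_mul_assoc, mul_smul_comm]

variable (k H) in
/-- `s ⊗ f ↦ f(q_R¹ s₁ p_L¹) q_R² s₂ p_L²` for left integrals `s`. -/
noncomputable def integralDualMap : leftIntegrals k H ⊗[k] Module.Dual k H →ₗ[k] H where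
  toFun z := evalMulMap (integralHom k H z) (qR k H)
  map_add' z z' := by rw [map_add, evalMulMap_add, LinearMap.add_apply]
  map_smul' c z := by rw [map_smul, evalMulMap_smul, LinearMap.smul_apply, RingHom.id_apply]

/-- If the evaluation at `q_R` vanishes, then so do those at all `q_R Δ(x)`; the associated
endomorphism is therefore zero, and `integralHom` is injective. -/
theorem integralDualMap_injective [FiniteDimensional k H]
    (hS : Function.Bijective (antipode k (H := H))) : Function.Injective (integralDualMap k H) := by
  rw [injective_iff_map_eq_zero]
  intro z hz
  refine integralHom_injective hS ?_
  rw [map_zero]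
  refine eq_zero_of_evalMulMap_qR_mul_comul hS fun x => ?_
  rw [evalMulMap_integralHom, show evalMulMap (integralHom k H z) (qR k H) = 0 from hz, smul_zero]

/-- The injection gives `dim(integrals) · dim H ≤ dim H`; the factor `dim H` is cancelled when it is
positive. -/
theorem finrank_leftIntegrals_le_one [FiniteDimensional k H]
    (hS : Function.Bijective (antipode k (H := H))) :
    Module.finrank k (leftIntegrals k H) ≤ 1 := by
  have h := LinearMap.finrank_le_finrank_of_injective (integralDualMap_injective (k := k) hS)
  rw [Module.finrank_tensorProduct, Subspace.dual_finrank_eq] at h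
  rcases Nat.eq_zero_or_pos (Module.finrank k H) with h0 | h0
  · exact (Submodule.finrank_le _).trans (h0.le.trans zero_le_one)
  · exact Nat.le_of_mul_le_mul_right (by rwa [one_mul]) h0

theorem IsLeftIntegral.exists_eq_smul [FiniteDimensional k H] {t s : H}
    (ht : IsLeftIntegral k t) (ht0 : t ≠ 0) (hs : IsLeftIntegral k s) : ∃ c : k, s = c • t := by
  have h1 := finrank_leftIntegrals_le_one (k := k) (antipode_bijective ht ht0)
  obtain ⟨v, hv⟩ := finrank_le_one_iff.mp h1
  obtain ⟨a, ha⟩ := hv ⟨t, ht⟩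
  obtain ⟨b, hb⟩ := hv ⟨s, hs⟩
  have ha' : a • (v : H) = t := congrArg Subtype.val ha
  have hb' : b • (v : H) = s := congrArg Subtype.val hb
  have ha0 : a ≠ 0 := by rintro rfl; exact ht0 (by rw [← ha', zero_smul])
  exact ⟨b * a⁻¹, by rw [← ha', ← hb', smul_smul, mul_assoc, inv_mul_cancel₀ ha0, mul_one]⟩

theorem IsLeftIntegral.mul_right {t : H} (ht : IsLeftIntegral k t) (g : H) :
    IsLeftIntegral k (t * g) := fun h => by rw [← mul_assoc, ht h, smul_mul_assoc]

theorem exists_isModular [FiniteDimensional k H] {t : H} (ht : IsLeftIntegral k t) (ht0 : t ≠ 0) :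
    ∃ γ : H →ₐ[k] k, IsModular k γ := by
  obtain ⟨f, hf⟩ := not_forall.mp (mt (Module.forall_dual_apply_eq_zero_iff k t).mp ht0)
  -- Since `th` is a multiple of `t`, the factor is `f(th)/f(t)`; this expression is visibly linear
  -- in `h`.
  let γ : H →ₗ[k] k := (f t)⁻¹ • f ∘ₗ LinearMap.mulLeft k t
  have hγ : ∀ h : H, t * h = γ h • t := by
    intro h
    obtain ⟨c, hc⟩ := ht.exists_eq_smul ht0 (ht.mul_right h)
    have : γ h = c := by
      simp only [γ, LinearMap.smul_apply, LinearMap.comp_apply, LinearMap.mulLeft_apply, hc,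
        map_smul, smul_eq_mul]
      rw [mul_comm, mul_assoc, mul_inv_cancel₀ hf, mul_one]
    rw [this, hc]
  have hinj : ∀ {a b : k}, a • t = b • t → a = b := fun h => smul_left_injective k ht0 h
  refine ⟨AlgHom.ofLinearMap γ (hinj ?_) (fun g h => hinj ?_), fun s hs h => ?_⟩
  · rw [← hγ, mul_one, one_smul]
  · rw [← hγ, ← mul_assoc, hγ g, smul_mul_assoc, hγ h, smul_smul]
  · obtain ⟨c, rfl⟩ := ht.exists_eq_smul ht0 hs
    rw [smul_mul_assoc, hγ h, smul_comm]
    rfl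

theorem isModular_modularElement [FiniteDimensional k H] {t : H} (ht : IsLeftIntegral k t)
    (ht0 : t ≠ 0) : IsModular k (modularElement k H) := by
  have h := exists_isModular ht ht0
  rw [modularElement, dif_pos h]
  exact h.choose_spec

end Integrals

/-! ### The pentagon identity behind the formula for `·_γ` -/

section LeftIntegralElement

variable {k H : Type*} [Field k] [Ring H] [Algebra k H] [QuasiHopfAlgebra k H]

variable (k H) in
/-- `x ⊗ y ⊗ z ⊗ u ↦ y S⁻¹(x β) ⊗ z ⊗ u`. -/
noncomputable def betaInvMap₄ : H ⊗[k] (H ⊗[k] (H ⊗[k] H)) →ₗ[k] H ⊗[k] (H ⊗[k] H) :=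
  TensorProduct.map (antipodeInv k H ∘ₗ betaMap k H) LinearMap.id ∘ₗ
    (TensorProduct.assoc k H H (H ⊗[k] H)).symm.toLinearMap

theorem betaInvMap₄_tmul (x y : H) (d : H ⊗[k] H) :
    betaInvMap₄ k H (x ⊗ₜ (y ⊗ₜ d)) =
      antipodeInv k H (x * beta k H * antipode k y) ⊗ₜ d := by
  simp [betaInvMap₄]

theorem betaInvMap₄_mul_D₁ (v : H ⊗[k] (H ⊗[k] (H ⊗[k] H))) (w : H ⊗[k] (H ⊗[k] H)) :
    betaInvMap₄ k H (v * D₁ w) =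
      betaInvMap₄ k H (v * ((1 : H) ⊗ₜ[k] ((1 : H) ⊗ₜ[k] L₁ w))) := by
  induction v using induction₄ with
  | zero => simp
  | add v w hv hw => simp only [add_mul, map_add, hv, hw]
  | tmul a b c e =>
    induction w using induction₃ with
    | zero => simp
    | add v w hv hw =>
      simp only [TensorProduct.tmul_add, map_add, mul_add] at hv hw ⊢
      rw [hv, hw]
    | tmul x y z =>
      have : ∀ d : H ⊗[k] H, betaInvMap₄ k H ((a ⊗ₜ (b ⊗ₜ (c ⊗ₜ e))) *
          Algebra.TensorProduct.assoc k k k H H (H ⊗[k] H) (d ⊗ₜ[k] (y ⊗ₜ[k] z))) =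
          antipodeInv k H (a * betaMap k H d * antipode k b) ⊗ₜ ((c * y) ⊗ₜ (e * z)) := by
        intro d
        induction d with
        | zero => simp
        | add v w hv hw => simp only [TensorProduct.add_tmul, map_add, add_mul, mul_add, hv, hw]
        | tmul x y => simp [betaInvMap₄_tmul, antipode_mul, mul_assoc]
      refine (this (comul k x)).trans ?_
      rw [betaMap_comul]
      simp [betaInvMap₄_tmul, TensorProduct.smul_tmul', mul_assoc]
      rw [TensorProduct.smul_tmul, TensorProduct.smul_tmul']

/-- The first leg of `w` enters leg two, inside `S⁻¹(x β S(-))`, and comes out on the left because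
`S⁻¹` reverses products. -/
theorem betaInvMap₄_one_tmul_mul_D₃ (hS : Function.Bijective (antipode k (H := H)))
    (w w' : H ⊗[k] (H ⊗[k] H)) :
    betaInvMap₄ k H (((1 : H) ⊗ₜ[k] w) * D₃ w') =
      w * Algebra.TensorProduct.map (AlgHom.id k H) (comul k) (pLMap k H w') := by
  induction w' using induction₃ with
  | zero => simp
  | add v w hv hw => simp only [map_add, mul_add, hv, hw]
  | tmul x y z =>
    change betaInvMap₄ k H (((1 : H) ⊗ₜ[k] w) * (x ⊗ₜ (y ⊗ₜ comul k z))) = _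
    rw [pLMap_tmul, Algebra.TensorProduct.map_tmul, AlgHom.id_apply]
    generalize comul k z = d
    induction w using induction₃ with
    | zero => simp
    | add v w hv hw => simp only [map_add, TensorProduct.tmul_add, add_mul, hv, hw]
    | tmul a b c =>
      rw [Algebra.TensorProduct.tmul_mul_tmul, Algebra.TensorProduct.tmul_mul_tmul,
        betaInvMap₄_tmul, Algebra.TensorProduct.tmul_mul_tmul, one_mul, antipode_mul, ← mul_assoc,
        antipodeInv_mul hS _ (antipode k a), antipodeInv_antipode hS]

variable (k H) in
/-- `x ⊗ y ⊗ z ↦ Δ(y) p_L (S⁻¹(x) ⊗ 1) ⊗ z`. -/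
noncomputable def pLTwist₃ : H ⊗[k] (H ⊗[k] H) →ₗ[k] H ⊗[k] (H ⊗[k] H) :=
  (TensorProduct.assoc k H H H).toLinearMap ∘ₗ TensorProduct.map (pLTwist k H) LinearMap.id ∘ₗ
    (TensorProduct.assoc k H H H).symm.toLinearMap

theorem pLTwist₃_tmul (x y z : H) :
    pLTwist₃ k H (x ⊗ₜ (y ⊗ₜ z)) = Algebra.TensorProduct.assoc k k k H H H
      ((comul k y * pL k H * (antipodeInv k H x ⊗ₜ 1)) ⊗ₜ z) := by
  rw [← pLTwist_tmul]; rfl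

theorem betaInvMap₄_D₂_mul_E₁_phi (hS : Function.Bijective (antipode k (H := H)))
    (w : H ⊗[k] (H ⊗[k] H)) :
    betaInvMap₄ k H (D₂ w * E₁ (phi k H)) = pLTwist₃ k H w := by
  induction w using induction₃ with
  | zero => simp
  | add v w hv hw => simp only [map_add, add_mul, hv, hw]
  | tmul x y z =>
    change betaInvMap₄ k H (x ⊗ₜ[k]
          Algebra.TensorProduct.assoc k k k H H H (comul k y ⊗ₜ[k] z) * _) = _
    rw [pLTwist₃_tmul, ← pLMap_phi hS]
    generalize comul k y = d
    generalize phi k H = w'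
    induction d with
    | zero => simp
    | add v w hv hw =>
      simp only [map_add, add_mul, TensorProduct.add_tmul, TensorProduct.tmul_add, hv, hw]
    | tmul d₁ d₂ =>
      induction w' using induction₃ with
      | zero => simp
      | add v w hv hw => simp only [map_add, mul_add, add_mul, TensorProduct.add_tmul, hv, hw]
      | tmul a b c =>
        simp [betaInvMap₄_tmul, pLMap_tmul, antipode_mul, antipodeInv_mul hS,
          antipodeInv_antipode hS, mul_assoc]

/-- `φ⁻¹ (I ⊗ Δ)(p_L) = Δ(X²) p_L (S⁻¹(X¹) ⊗ 1) ⊗ X³`. -/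
theorem phiInv_mul_map_comul_pL (hS : Function.Bijective (antipode k (H := H))) :
    phiInv k H * Algebra.TensorProduct.map (AlgHom.id k H) (comul k) (pL k H) =
      pLTwist₃ k H (phi k H) := by
  -- Only the first two legs are contracted: `D₁ φ` disappears by `β`, and each remaining side
  -- contains one copy of `p_L`.
  have h := congrArg (betaInvMap₄ k H) (D₂_phi_mul_E₁_phi (k := k) (H := H))
  rw [betaInvMap₄_D₂_mul_E₁_phi hS, betaInvMap₄_mul_D₁, L₁_phi, ← Algebra.TensorProduct.one_def,
    ← Algebra.TensorProduct.one_def, mul_one, betaInvMap₄_one_tmul_mul_D₃ hS, pLMap_phi hS] at h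
  exact h.symm

/-- `γ(d₂) d₁ = Λ (γ ⇀ h)` for `d = q_L Δ(h)`. -/
theorem rid_modularElement_qL_mul_comul (h : H) :
    TensorProduct.rid k H (TensorProduct.map LinearMap.id (modularElement k H).toLinearMap
      (qL k H * comul k h)) = Lam k H * gammaHarpoon k H h :=
  map_mul ((Algebra.TensorProduct.rid k k H).toAlgHom.comp
    (Algebra.TensorProduct.map (AlgHom.id k H) (modularElement k H))) _ _

end LeftIntegralElement

/-! ### Computation rules in the smash product -/

section SmashProduct

variable {k H A : Type*} [Field k] [Ring H] [Algebra k H]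
  [NonAssocRing A] [Module k A] [Module H A] [IsScalarTower k H A]

variable (k H) in
/-- `x ⊗ y ↦ x · b # y`. -/
noncomputable def smashOrbit (b : A) : H ⊗[k] H →ₗ[k] SmashProduct k H A :=
  TensorProduct.map (orbit k H b) LinearMap.id

@[simp] theorem smashOrbit_tmul (b : A) (x y : H) :
    smashOrbit k H b (x ⊗ₜ y) = SmashProduct.mk k H (x • b) y := rfl

variable [IsScalarTower k A A] [SMulCommClass k A A]

theorem varphi_eq_smashOrbit [QuasiHopfAlgebra k H] [QuasiModuleAlgebra k H A] (h : H) (a : A) :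
    varphi k H h a = smashOrbit k H a (comul k h * pL k H) := rfl

theorem pLSmash_eq_smashOrbit [QuasiHopfAlgebra k H] [QuasiModuleAlgebra k H A] (a : A) :
    pLSmash k H a = smashOrbit k H a (pL k H) := rfl

section QuasiBialgebra

variable [QuasiBialgebra k H]

variable (k H) in
/-- `x ⊗ y ⊗ z ↦ (x · a)(y · b) # z`. -/
noncomputable def smashOrbitMul (a b : A) : H ⊗[k] (H ⊗[k] H) →ₗ[k] SmashProduct k H A :=
  SmashProduct.mulAux k H a b

@[simp] theorem smashOrbitMul_tmul (a b : A) (x y z : H) :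
    smashOrbitMul k H a b (x ⊗ₜ (y ⊗ₜ z)) = SmashProduct.mk k H ((x • a) * (y • b)) z :=
  SmashProduct.mulAux_tmul a b x y z

theorem mk_mul_mk_of_invariant_left {b : A} (hb : b ∈ invariants k H A) (c : A) (h : H) :
    SmashProduct.mk k H b 1 * SmashProduct.mk k H c h = SmashProduct.mk k H (b * c) h := by
  have : ∀ w : H ⊗[k] (H ⊗[k] H), SmashProduct.mulAux k H b c w =
      TensorProduct.map (LinearMap.mulLeft k b ∘ₗ orbit k H c) LinearMap.id (L₁ w) := by
    intro w
    induction w using induction₃ with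
    | zero => simp
    | add v w hv hw => simp only [map_add, hv, hw]
    | tmul x y z =>
      rw [SmashProduct.mulAux_tmul, hb x]
      simp [smul_mul_assoc, TensorProduct.smul_tmul']
  rw [SmashProduct.mul_mk, this, map_mul, L₁_phiInv, one_mul, map_one, one_mul]
  simp
  rfl

theorem mk_mul_mk_of_invariant_right {b : A} (hb : b ∈ invariants k H A) (a : A) :
    SmashProduct.mk k H a 1 * SmashProduct.mk k H b 1 = SmashProduct.mk k H (a * b) 1 := by
  have : ∀ w : H ⊗[k] (H ⊗[k] H), SmashProduct.mulAux k H a b w =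
      TensorProduct.map (LinearMap.mulRight k b ∘ₗ orbit k H a) LinearMap.id (L₂ w) := by
    intro w
    induction w using induction₃ with
    | zero => simp
    | add v w hv hw => simp only [map_add, hv, hw]
    | tmul x y z =>
      rw [SmashProduct.mulAux_tmul, hb y]
      simp [mul_smul_comm, TensorProduct.smul_tmul']
  rw [SmashProduct.mul_mk, this, map_mul, L₂_phiInv, one_mul, map_one, one_mul]
  simp
  rfl

variable [QuasiModuleAlgebra k H A]

theorem one_mk_mul_mk (h : H) (b : A) (g : H) :
    SmashProduct.mk k H (1 : A) h * SmashProduct.mk k H b g =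
      smashOrbit k H b (comul k h * (1 ⊗ₜ[k] g)) := by
  rw [SmashProduct.mul_mk, SmashProduct.mulAux_one_left, map_mul, L₁_phiInv, one_mul]
  simp
  rfl

theorem one_mk_mul_smashOrbit (h : H) (b : A) (d : H ⊗[k] H) :
    SmashProduct.mk k H (1 : A) h * smashOrbit k H b d = smashOrbit k H b (comul k h * d) := by
  induction d with
  | zero => simp
  | add d d' hd hd' => simp only [map_add, mul_add, hd, hd']
  | tmul x y =>
    rw [smashOrbit_tmul, one_mk_mul_mk]
    generalize comul k h = e
    induction e with
    | zero => simp
    | add d d' hd hd' => simp only [map_add, add_mul, hd, hd']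
    | tmul a b => simp [mul_smul]

theorem smashOrbit_one (d : H ⊗[k] H) :
    smashOrbit k H (1 : A) d = SmashProduct.mk k H 1 (L₀ d) := by
  induction d with
  | zero => simp [SmashProduct.mk]; rfl
  | add d d' hd hd' =>
    rw [map_add, map_add, hd, hd']; exact (TensorProduct.tmul_add _ _ _).symm
  | tmul x y =>
    rw [smashOrbit_tmul, QuasiModuleAlgebra.smul_one (k := k)]
    simp [SmashProduct.mk, TensorProduct.smul_tmul']
    rfl

theorem one_mk_mul_one_mk (g h : H) :
    SmashProduct.mk k H (1 : A) g * SmashProduct.mk k H 1 h = SmashProduct.mk k H 1 (g * h) := by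
  rw [one_mk_mul_mk, smashOrbit_one, map_mul, L₀_comul]
  simp

theorem mk_one_mul_one_mk (a : A) (h : H) :
    SmashProduct.mk k H a 1 * SmashProduct.mk k H 1 h = SmashProduct.mk k H a h := by
  rw [SmashProduct.mul_mk, SmashProduct.mulAux_one_right, map_mul, L₂_phiInv, one_mul, map_one,
    one_mul]
  simp
  rfl

theorem smul_mul_of_invariant_left {b : A} (hb : b ∈ invariants k H A) (h : H) (a : A) :
    h • (b * a) = b * (h • a) := by
  rw [QuasiModuleAlgebra.smul_mul (k := k), actMul_invariants hb, L₀_comul]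

theorem smul_mul_of_invariant_right {b : A} (hb : b ∈ invariants k H A) (h : H) (a : A) :
    h • (a * b) = (h • a) * b := by
  have : ∀ d : H ⊗[k] H, actMul k H a b d = (R₀ d • a) * b := by
    intro d
    induction d with
    | zero => simp
    | add d d' hd hd' => simp only [map_add, add_smul, add_mul, hd, hd']
    | tmul x y => rw [actMul_tmul, hb y]; simp [mul_smul_comm, smul_mul_assoc]
  rw [QuasiModuleAlgebra.smul_mul (k := k), this, R₀_comul]

/-- An invariant third factor sees only the counit of `X³`, and `L₃ φ = 1` trivializes the
associator. -/
theorem mul_assoc_of_right {b : A} (hb : b ∈ invariants k H A) (c a : A) :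
    (c * a) * b = c * (a * b) := by
  have key : ∀ w : H ⊗[k] (H ⊗[k] H), actMulMul k H c a b w =
      LinearMap.mul' k A (TensorProduct.map (orbit k H c)
        (LinearMap.mulRight k b ∘ₗ orbit k H a) (L₃ w)) := by
    intro w
    induction w using induction₃ with
    | zero => simp
    | add v w hv hw => simp only [map_add, hv, hw]
    | tmul x y z => rw [actMulMul_tmul, actMul_tmul, hb z]; simp [mul_smul_comm]
  rw [QuasiModuleAlgebra.mul_mul (k := k) (H := H), key, L₃_phi]
  simp [Algebra.TensorProduct.one_def]

theorem smul_actMul (h : H) (a b : A) (p : H ⊗[k] H) :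
    h • actMul k H a b p = actMul k H a b (comul k h * p) := by
  induction p with
  | zero => simp
  | add p p' hp hp' => simp only [map_add, smul_add, mul_add, hp, hp']
  | tmul x y => rw [actMul_tmul, QuasiModuleAlgebra.smul_mul (k := k), actMul_mul_tmul]

theorem smashOrbit_smul (b c : A) (d : H ⊗[k] H) :
    smashOrbit k H b d • c = actMul k H b c d := by
  induction d with
  | zero => simp
  | add d d' hd hd' => simp only [map_add, add_smul, hd, hd']
  | tmul x y => rw [smashOrbit_tmul, SmashProduct.mk_smul, actMul_tmul]

theorem smashOrbit_mul_of_invariant {b : A} (hb : b ∈ invariants k H A) (a : A) (d : H ⊗[k] H) :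
    smashOrbit k H (b * a) d = SmashProduct.mk k H b 1 * smashOrbit k H a d := by
  induction d with
  | zero => simp
  | add d d' hd hd' => simp only [map_add, mul_add, hd, hd']
  | tmul x y =>
    rw [smashOrbit_tmul, smashOrbit_tmul, mk_mul_mk_of_invariant_left hb,
      smul_mul_of_invariant_left hb]

theorem mk_mul_of_mem_invariants {y : SmashProduct k H A} (hy : y ∈ SmashProduct.invariants k H A)
    (a : A) (h : H) : SmashProduct.mk k H a h * y = counit k h • (SmashProduct.mk k H a 1 * y) := by
  rw [← mk_one_mul_one_mk, mul_assoc, hy h, mul_smul_comm]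

/-- Next to an invariant `y`, the factor `H` of an element of `A # H` acts by `ε`. What remains of
`(c # h)(a # 1)` after this counit is `c(h·a)`, which is the action on `A`. -/
theorem mk_smul_one_mul {y : SmashProduct k H A} (hy : y ∈ SmashProduct.invariants k H A)
    (x : SmashProduct k H A) (a : A) :
    SmashProduct.mk k H (x • a) 1 * y = x * SmashProduct.mk k H a 1 * y := by
  have mk_add : ∀ a b : A, SmashProduct.mk k H (a + b) 1 =
      SmashProduct.mk k H a 1 + SmashProduct.mk k H b 1 := fun a b => TensorProduct.add_tmul _ _ _
  have mk_zero : SmashProduct.mk k H (0 : A) 1 = 0 := TensorProduct.zero_tmul _ _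
  have mk_smul : ∀ (c : k) (a : A), SmashProduct.mk k H (c • a) 1 = c • SmashProduct.mk k H a 1 :=
    fun c a => rfl
  induction x using SmashProduct.induction_on with
  | zero => rw [zero_smul, mk_zero, zero_mul, zero_mul, zero_mul]
  | add x x' hx hx' => rw [add_smul, mk_add, add_mul, add_mul, add_mul, hx, hx']
  | mk c h =>
    have key : ∀ w : H ⊗[k] (H ⊗[k] H), smashOrbitMul k H c a w * y =
        SmashProduct.mk k H (actMul k H c a (L₃ w)) 1 * y := by
      intro w
      induction w using induction₃ with
      | zero => simp only [map_zero, mk_zero, zero_mul]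
      | add v w hv hw => simp only [map_add, mk_add, add_mul, hv, hw]
      | tmul p q r =>
        rw [smashOrbitMul_tmul, mk_mul_of_mem_invariants hy]
        simp [mk_smul]
    rw [SmashProduct.mul_mk]
    refine Eq.trans ?_ (key _).symm
    -- The counit on the third leg kills `φ⁻¹` and the second leg of `Δ(h)`.
    have h3 : L₃ (phiInv k H * (1 ⊗ₜ[k] (comul k h * (1 ⊗ₜ[k] 1)))) = (1 : H) ⊗ₜ[k] h := by
      rw [map_mul, L₃_phiInv, one_mul, ← Algebra.TensorProduct.one_def, mul_one]
      exact congrArg ((1 : H) ⊗ₜ[k] ·) (R₀_comul h)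
    rw [h3, actMul_tmul, one_smul, SmashProduct.mk_smul]

end QuasiBialgebra

end SmashProduct

/-! ### Invariants of `A # H`, the transported action and the Morita context -/

section Transport

variable {k H A : Type*} [Field k] [Ring H] [Algebra k H] [QuasiHopfAlgebra k H]
  [NonAssocRing A] [Module k A] [IsScalarTower k A A] [SMulCommClass k A A]
  [Module H A] [IsScalarTower k H A] [QuasiModuleAlgebra k H A]

theorem varphi_eq_mul (h : H) (a : A) :
    varphi k H h a = SmashProduct.mk k H 1 h * pLSmash k H a := by
  rw [varphi_eq_smashOrbit, pLSmash_eq_smashOrbit, one_mk_mul_smashOrbit]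

theorem one_mk_mul_varphi (g h : H) (a : A) :
    SmashProduct.mk k H 1 g * varphi k H h a = varphi k H (g * h) a := by
  rw [varphi_eq_mul, varphi_eq_mul, ← mul_assoc, one_mk_mul_one_mk]

variable (k H A) in
/-- `h ⊗ a ↦ h₁ p_L¹ · a # h₂ p_L²`. -/
noncomputable def varphiMap : H ⊗[k] A →ₗ[k] SmashProduct k H A :=
  diagonalMap (Algebra.lsmul k k A)

@[simp] theorem varphiMap_tmul (h : H) (a : A) : varphiMap k H A (h ⊗ₜ a) = varphi k H h a := rfl

theorem varphiMap_bijective (hS : Function.Bijective (antipode k (H := H))) :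
    Function.Bijective (varphiMap k H A) :=
  Function.bijective_iff_has_inverse.mpr ⟨diagonalInv (Algebra.lsmul k k A),
    diagonalInv_diagonalMap _ hS, diagonalMap_diagonalInv _ hS⟩

theorem one_mk_mul_varphiMap (g : H) (z : H ⊗[k] A) :
    SmashProduct.mk k H 1 g * varphiMap k H A z =
      varphiMap k H A (TensorProduct.map (LinearMap.mulLeft k g) LinearMap.id z) := by
  induction z with
  | zero => simp
  | add z z' hz hz' => simp only [map_add, mul_add, hz, hz']
  | tmul h a => simp [one_mk_mul_varphi]

theorem smul_varphi (c : k) (h : H) (a : A) : varphi k H (c • h) a = c • varphi k H h a := by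
  rw [← varphiMap_tmul, ← TensorProduct.smul_tmul', map_smul]; rfl

theorem varphi_add (h : H) (a b : A) : varphi k H h (a + b) = varphi k H h a + varphi k H h b := by
  rw [← varphiMap_tmul, TensorProduct.tmul_add, map_add]; rfl

theorem varphi_smul (c : k) (h : H) (a : A) : varphi k H h (c • a) = c • varphi k H h a := by
  rw [← varphiMap_tmul, TensorProduct.tmul_smul, map_smul]; rfl

theorem varphi_zero (h : H) : varphi k H h (0 : A) = 0 := by
  rw [← varphiMap_tmul, TensorProduct.tmul_zero, map_zero]

/-- `varphiMap` is injective, and so is `a ↦ t ⊗ a` because `t ≠ 0`. Later identities in `A` are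
proved by cancelling this map. -/
theorem varphi_injective {t : H} (hS : Function.Bijective (antipode k (H := H))) (ht0 : t ≠ 0) :
    Function.Injective (fun a : A => varphi k H t a) := by
  intro a b hab
  have h := (varphiMap_bijective hS).1 (a₁ := t ⊗ₜ a) (a₂ := t ⊗ₜ b) hab
  obtain ⟨f, hf⟩ := not_forall.mp (mt (Module.forall_dual_apply_eq_zero_iff k t).mp ht0)
  have h' := congrArg ((TensorProduct.lid k A).toLinearMap ∘ₗ TensorProduct.map f LinearMap.id) h
  exact smul_right_injective A hf (by simpa using h')

theorem varphi_mem_invariants {t : H} (ht : IsLeftIntegral k t) (a : A) :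
    varphi k H t a ∈ SmashProduct.invariants k H A := fun h => by
  rw [one_mk_mul_varphi, ht h, smul_varphi]

/-- Pulled back to `H ⊗ A`, invariance concerns only the factor `H`: the coefficients over a basis
of `A` are left integrals, hence multiples of `t`. -/
theorem exists_varphi_eq [FiniteDimensional k H] {t : H} (ht : IsLeftIntegral k t) (ht0 : t ≠ 0)
    {x : SmashProduct k H A} (hx : x ∈ SmashProduct.invariants k H A) :
    ∃ a : A, varphi k H t a = x := by
  have hφ := varphiMap_bijective (A := A) (antipode_bijective ht ht0)
  obtain ⟨z, rfl⟩ := hφ.2 x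
  have hz : ∀ g : H, TensorProduct.map (LinearMap.mulLeft k g) LinearMap.id z = counit k g • z :=
    fun g => hφ.1 (by rw [← one_mk_mul_varphiMap, hx g, map_smul])
  obtain ⟨c, rfl⟩ := TensorProduct.eq_repr_basis_right (Module.Basis.ofVectorSpace k A) z
  have hc : ∀ m, IsLeftIntegral k (c m) := by
    intro m g
    have h1 : (c.mapRange (fun n => g * n - counit k g • n) (by simp)).sum
        (fun i n => n ⊗ₜ[k] Module.Basis.ofVectorSpace k A i) = 0 := by
      have h2 := hz g
      rw [← sub_eq_zero, Finsupp.sum, map_sum, Finset.smul_sum, ← Finset.sum_sub_distrib] at h2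
      rw [Finsupp.sum_mapRange_index (by simp), ← h2, Finsupp.sum]
      exact Finset.sum_congr rfl fun i _ => by
        simp [TensorProduct.sub_tmul, TensorProduct.smul_tmul']
    have := DFunLike.congr_fun (TensorProduct.sum_tmul_basis_right_eq_zero _ _ h1) m
    simpa [sub_eq_zero] using this
  choose r hr using fun m => ht.exists_eq_smul ht0 (hc m)
  refine ⟨∑ m ∈ c.support, r m • Module.Basis.ofVectorSpace k A m, ?_⟩
  rw [← varphiMap_tmul, TensorProduct.tmul_sum, Finsupp.sum]
  congr 1
  exact Finset.sum_congr rfl fun i _ => by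
    rw [TensorProduct.tmul_smul, TensorProduct.smul_tmul', ← hr]

variable (k H A) in
/-- `a # h ↦ S⁻¹(Λ (γ ⇀ h)) · a`. -/
noncomputable def modularCollapse : SmashProduct k H A →ₗ[k] A :=
  (TensorProduct.lid k A).toLinearMap ∘ₗ
    TensorProduct.map (modularElement k H).toLinearMap LinearMap.id ∘ₗ
      diagonalInv (Algebra.lsmul k k A)

theorem modularCollapse_mk (a : A) (h : H) :
    modularCollapse k H A (SmashProduct.mk k H a h) =
      antipodeInv k H (Lam k H * gammaHarpoon k H h) • a := by
  rw [← rid_modularElement_qL_mul_comul]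
  change TensorProduct.lid k A (TensorProduct.map (modularElement k H).toLinearMap LinearMap.id
    (invTensorOrbit (Algebra.lsmul k k A) a (qL k H * comul k h))) = _
  generalize qL k H * comul k h = d
  induction d with
  | zero => simp
  | add d d' hd hd' => simp only [map_add, add_smul, hd, hd']
  | tmul x y => simp

/-- For `x = φ(g ⊗ a)` the left side is `φ(tg ⊗ a) = γ(g)φ(t ⊗ a)`, while `modularCollapse` is `γ ⊗
I` after the inverse of `varphiMap`. -/
theorem one_mk_mul_eq_varphi {t : H} (hS : Function.Bijective (antipode k (H := H)))
    (ht : IsLeftIntegral k t) (hγ : IsModular k (modularElement k H)) (x : SmashProduct k H A) :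
    SmashProduct.mk k H 1 t * x = varphi k H t (modularCollapse k H A x) := by
  obtain ⟨z, rfl⟩ := (varphiMap_bijective hS).2 x
  have h : modularCollapse k H A (varphiMap k H A z) = TensorProduct.lid k A
      (TensorProduct.map (modularElement k H).toLinearMap LinearMap.id z) :=
    congrArg (fun z => TensorProduct.lid k A
      (TensorProduct.map (modularElement k H).toLinearMap LinearMap.id z))
      (diagonalInv_diagonalMap (Algebra.lsmul k k A) hS z)
  rw [h]
  induction z with
  | zero => simp [varphi_zero]
  | add z z' hz hz' =>
    have h' := fun w : H ⊗[k] A => congrArg (fun z => TensorProduct.lid k A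
      (TensorProduct.map (modularElement k H).toLinearMap LinearMap.id z))
      (diagonalInv_diagonalMap (Algebra.lsmul k k A) hS w)
    rw [map_add, mul_add, hz (h' z), hz' (h' z'), ← varphi_add, map_add, map_add]
  | tmul g a =>
    rw [varphiMap_tmul, one_mk_mul_varphi, hγ t ht g, smul_varphi]
    simp [varphi_smul]

theorem pLSmash_mul_mk (a b : A) (h : H) :
    pLSmash k H a * SmashProduct.mk k H b h = smashOrbitMul k H a b
      (phiInv k H * Algebra.TensorProduct.map (AlgHom.id k H) (comul k) (pL k H) *
        ((1 : H) ⊗ₜ[k] ((1 : H) ⊗ₜ[k] h))) := by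
  rw [pLSmash_eq_smashOrbit]
  generalize pL k H = d
  induction d with
  | zero => simp
  | add d d' hd hd' => simp only [map_add, add_mul, mul_add, hd, hd']
  | tmul x y =>
    have : ∀ (w : H ⊗[k] (H ⊗[k] H)) (e : H ⊗[k] H), SmashProduct.mulAux k H (x • a) b
        (w * (1 ⊗ₜ[k] e)) = SmashProduct.mulAux k H a b (w * (x ⊗ₜ[k] e)) := by
      intro w e
      induction w using induction₃ with
      | zero => simp
      | add v w hv hw => simp only [map_add, add_mul, hv, hw]
      | tmul p q r =>
        induction e with
        | zero => simp
        | add v w hv hw => simp only [map_add, mul_add, TensorProduct.tmul_add, hv, hw]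
        | tmul e₁ e₂ => simp [mul_smul]
    rw [smashOrbit_tmul, SmashProduct.mul_mk, this, mul_assoc, Algebra.TensorProduct.map_tmul,
      Algebra.TensorProduct.tmul_mul_tmul, mul_one]
    rfl

/-- By `phiInv_mul_map_comul_pL` the product carries `Δ(X²)` in front of `p_L`. The module algebra
axiom turns it into `X²` acting from outside, where it joins `S⁻¹(Λ(γ ⇀ X³h))` as the factor `S(X²)`
under `S⁻¹`. -/
theorem modularCollapse_pLSmash_mul (hS : Function.Bijective (antipode k (H := H))) (a : A)
    (x : SmashProduct k H A) :
    modularCollapse k H A (pLSmash k H a * x) = gammaAction k H a x := by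
  induction x using SmashProduct.induction_on with
  | zero => simp
  | add x x' hx hx' => simp only [mul_add, map_add, hx, hx']
  | mk b h =>
    rw [pLSmash_mul_mk, phiInv_mul_map_comul_pL hS]
    change _ = TensorProduct.lift (Algebra.lsmul k k A : H →ₐ[k] Module.End k A).toLinearMap.flip
      (TensorProduct.map
        (actMul k H a b ∘ₗ LinearMap.mulLeft k (pL k H) ∘ₗ
          (TensorProduct.mk k H H).flip 1 ∘ₗ antipodeInv k H)
        (antipodeInv k H ∘ₗ LinearMap.mul' k H ∘ₗ
          TensorProduct.map (antipode k)
            (LinearMap.mulLeft k (Lam k H) ∘ₗ gammaHarpoon k H ∘ₗ LinearMap.mulRight k h))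
        (phi k H))
    generalize phi k H = w
    induction w using induction₃ with
    | zero => simp
    | add v w hv hw => simp only [map_add, add_mul, hv, hw]
    | tmul p q r =>
      have key : ∀ d : H ⊗[k] H, smashOrbitMul k H a b
          (Algebra.TensorProduct.assoc k k k H H H (d ⊗ₜ[k] r) *
            ((1 : H) ⊗ₜ[k] ((1 : H) ⊗ₜ[k] h))) =
          SmashProduct.mk k H (actMul k H a b d) (r * h) := by
        intro d
        induction d with
        | zero => simp [SmashProduct.mk]; rfl
        | add v w hv hw =>
          simp only [TensorProduct.add_tmul, map_add, add_mul, hv, hw]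
          exact (TensorProduct.add_tmul _ _ _).symm
        | tmul x y => simp
      rw [pLTwist₃_tmul, key, modularCollapse_mk, mul_assoc, ← smul_actMul, smul_smul]
      simp [antipodeInv_mul hS, antipodeInv_antipode hS, mul_smul]

theorem varphi_gammaAction [FiniteDimensional k H] {t : H} (ht : IsLeftIntegral k t) (ht0 : t ≠ 0)
    (a : A) (x : SmashProduct k H A) :
    varphi k H t (gammaAction k H a x) = varphi k H t a * x := by
  have hS := antipode_bijective ht ht0
  rw [← modularCollapse_pLSmash_mul hS,
    ← one_mk_mul_eq_varphi hS ht (isModular_modularElement ht ht0), varphi_eq_mul, mul_assoc]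

/-- The right action of `A # H` on `A` given by `gammaAction`. -/
noncomputable abbrev gammaModule [FiniteDimensional k H] {t : H} (ht : IsLeftIntegral k t)
    (ht0 : t ≠ 0) : Module (SmashProduct k H A)ᵐᵒᵖ A :=
  have inj := varphi_injective (A := A) (antipode_bijective ht ht0) ht0
  have act := varphi_gammaAction (A := A) ht ht0
  { smul := fun x a => gammaAction k H a x.unop
    one_smul := fun a => inj ((act a 1).trans (mul_one _))
    mul_smul := fun x y a => inj (by
      change varphi k H t (gammaAction k H a (y.unop * x.unop)) =
        varphi k H t (gammaAction k H (gammaAction k H a y.unop) x.unop)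
      rw [act, act, act, mul_assoc])
    smul_zero := fun x => inj (by
      change varphi k H t (gammaAction k H 0 x.unop) = varphi k H t 0
      rw [act, varphi_zero, zero_mul])
    smul_add := fun x a b => inj (by
      change varphi k H t (gammaAction k H (a + b) x.unop) =
        varphi k H t (gammaAction k H a x.unop + gammaAction k H b x.unop)
      rw [act, varphi_add, varphi_add, act, act, add_mul])
    add_smul := fun x y a => map_add (gammaAction k H a) x.unop y.unop
    zero_smul := fun a => map_zero (gammaAction k H a) }

theorem varphi_smul_eq_roundMap {t : H} (ht : IsLeftIntegral k t) (a b : A) :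
    varphi k H t a • b = (roundMap k H t ht a b : A) := by
  rw [varphi_eq_smashOrbit, smashOrbit_smul, ← smul_actMul]
  rfl

theorem squareMap_eq_mul_varphi (t : H) (a b : A) :
    squareMap k H t a b = SmashProduct.mk k H a 1 * varphi k H t b := by
  rw [varphi_eq_mul, ← mul_assoc, mk_one_mul_one_mk]
  rfl

/-- This makes left multiplication by `A^H` commute with `·_γ`: the former becomes left
multiplication by `b # 1` in `A # H`, the latter right multiplication. -/
theorem varphi_mul_of_invariant {b : A} (hb : b ∈ invariants k H A) (h : H) (a : A) :
    varphi k H h (b * a) = SmashProduct.mk k H b 1 * varphi k H h a := by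
  rw [varphi_eq_smashOrbit, varphi_eq_smashOrbit, smashOrbit_mul_of_invariant hb]

theorem smul_mul_invariant {b : A} (hb : b ∈ invariants k H A) (x : SmashProduct k H A) (a : A) :
    x • (a * b) = (x • a) * b := by
  induction x using SmashProduct.induction_on with
  | zero => simp only [zero_smul, zero_mul]
  | add x x' hx hx' => simp only [add_smul, add_mul, hx, hx']
  | mk c h =>
    rw [SmashProduct.mk_smul, SmashProduct.mk_smul, smul_mul_of_invariant_right hb,
      mul_assoc_of_right hb]

theorem mk_one_smul {b : A} (a : A) : SmashProduct.mk k H b 1 • a = b * a := by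
  rw [SmashProduct.mk_smul, one_smul]

theorem algebraMap_smashProduct_smul (c : k) (a : A) :
    algebraMap k (SmashProduct k H A) c • a = c • a := by
  rw [Algebra.algebraMap_eq_smul_one]
  change SmashProduct.mk k H (c • (1 : A)) 1 • a = c • a
  rw [mk_one_smul, smul_mul_assoc, one_mul]

theorem isMoritaContext_gammaModule [FiniteDimensional k H] {t : H} (ht : IsLeftIntegral k t)
    (ht0 : t ≠ 0) :
    letI := gammaModule (A := A) ht ht0
    IsMoritaContext k (SmashProduct k H A) (invariants k H A) A A (roundMap k H t ht)
      (squareMap k H t) := by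
  let _ := gammaModule (A := A) ht ht0
  have inj := varphi_injective (A := A) (antipode_bijective ht ht0) ht0
  have act : ∀ (a : A) (x : SmashProduct k H A),
    varphi k H t (op x • a) = varphi k H t a * x := varphi_gammaAction (A := A) ht ht0
  have opB : ∀ (b : invariants k H A) (a : A), op b • a = a * b.1 := fun b a => rfl
  have smulB : ∀ (b : invariants k H A) (a : A), b • a = b.1 * a := fun b a => rfl
  have mulB : ∀ b c : invariants k H A, (b * c).1 = b.1 * c.1 := fun b c => rfl
  have algB : ∀ c : k, (algebraMap k (invariants k H A) c).1 = c • (1 : A) := fun c => by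
    rw [Algebra.algebraMap_eq_smul_one]; rfl
  exact
  { algebraMap_smul_left_P := algebraMap_smashProduct_smul
    algebraMap_smul_right_P := fun c a => by rw [opB, algB, mul_smul_comm, mul_one]
    algebraMap_smul_left_Q := fun c a => by rw [smulB, algB, smul_mul_assoc, one_mul]
    algebraMap_smul_right_Q := fun c a => inj (by
      change varphi k H t (op (algebraMap k (SmashProduct k H A) c) • a) = varphi k H t (c • a)
      rw [act, varphi_smul, ← Algebra.commutes, ← Algebra.smul_def])
    bimodule_P := fun x b a => by rw [opB, opB, smul_mul_invariant b.2]
    bimodule_Q := fun b x a => inj (by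
      change varphi k H t (b • (op x • a)) = varphi k H t (op x • (b • a))
      rw [smulB, varphi_mul_of_invariant b.2, act, act, smulB, varphi_mul_of_invariant b.2,
        mul_assoc])
    round_balanced := fun a x b => Subtype.ext (by
      rw [← varphi_smul_eq_roundMap, ← varphi_smul_eq_roundMap, act, mul_smul])
    round_left := fun b a c => Subtype.ext (by
      rw [mulB, ← varphi_smul_eq_roundMap, ← varphi_smul_eq_roundMap, smulB,
        varphi_mul_of_invariant b.2, mul_smul, mk_one_smul])
    round_right := fun a c b => Subtype.ext (by
      rw [mulB, ← varphi_smul_eq_roundMap, ← varphi_smul_eq_roundMap, opB, smul_mul_invariant b.2])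
    square_balanced := fun a b c => by
      rw [squareMap_eq_mul_varphi, squareMap_eq_mul_varphi, opB, smulB,
        varphi_mul_of_invariant b.2, ← mul_assoc, mk_mul_mk_of_invariant_right b.2]
    square_left := fun x a b => by
      rw [squareMap_eq_mul_varphi, squareMap_eq_mul_varphi, ← mul_assoc,
        mk_smul_one_mul (varphi_mem_invariants ht b)]
    square_right := fun a b x => by
      rw [squareMap_eq_mul_varphi, squareMap_eq_mul_varphi, act, mul_assoc]
    square_round := fun a b c => by
      rw [squareMap_eq_mul_varphi, mul_smul, mk_one_smul, varphi_smul_eq_roundMap, opB]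
    -- Under `φ(t ⊗ -)` both sides become `φ(t ⊗ a)(b # 1)φ(t ⊗ c)`, since `(a, b) = φ(t ⊗ a)·b` and
    -- `φ(t ⊗ c)` is invariant.
    round_square := fun a b c => inj (by
      change varphi k H t (roundMap k H t ht a b • c) = varphi k H t (op (squareMap k H t b c) • a)
      rw [act, squareMap_eq_mul_varphi, smulB, varphi_mul_of_invariant (roundMap k H t ht a b).2,
        ← varphi_smul_eq_roundMap, mk_smul_one_mul (varphi_mem_invariants ht c), mul_assoc]) }

end Transport

end QuasiHopf

theorem mainTheorem1 {k H A : Type*} [Field k]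
    [Ring H] [Algebra k H] [QuasiHopfAlgebra k H] [FiniteDimensional k H]
    [NonAssocRing A] [Module k A] [IsScalarTower k A A] [SMulCommClass k A A]
    [Module H A] [IsScalarTower k H A] [QuasiModuleAlgebra k H A]
    (t : H) (ht : QuasiHopf.IsLeftIntegral k t) (ht0 : t ≠ 0) :
    Function.Bijective (QuasiHopf.antipode k (H := H)) ∧
    QuasiHopf.IsModular k (QuasiHopf.modularElement k H) ∧
    Set.BijOn (fun a : A => QuasiHopf.varphi k H t a) Set.univ
      (QuasiHopf.SmashProduct.invariants k H A) ∧
    ∃ _ : Module (QuasiHopf.SmashProduct k H A)ᵐᵒᵖ A,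
      (∀ (a : A) (x : QuasiHopf.SmashProduct k H A),
        MulOpposite.op x • a = QuasiHopf.gammaAction k H a x) ∧
      (∀ (a : A) (x : QuasiHopf.SmashProduct k H A),
        QuasiHopf.varphi k H t (MulOpposite.op x • a) = QuasiHopf.varphi k H t a * x) ∧
      IsMoritaContext k (QuasiHopf.SmashProduct k H A) (QuasiHopf.invariants k H A) A A
        (QuasiHopf.roundMap k H t ht) (QuasiHopf.squareMap k H t) := by
  have hS := QuasiHopf.antipode_bijective ht ht0
  refine ⟨hS, QuasiHopf.isModular_modularElement ht ht0,
    ⟨fun a _ => QuasiHopf.varphi_mem_invariants ht a,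
      (QuasiHopf.varphi_injective hS ht0).injOn, fun x hx => ?_⟩,
    QuasiHopf.gammaModule ht ht0, fun a x => rfl, QuasiHopf.varphi_gammaAction ht ht0,
    QuasiHopf.isMoritaContext_gammaModule ht ht0⟩
  obtain ⟨a, ha⟩ := QuasiHopf.exists_varphi_eq ht ht0 hx
  exact ⟨a, Set.mem_univ a, ha⟩
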